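/- Let $K$ be a nonarchimedean local field (for instance a $p$-adic number field) with ring of integers $O_K$, uniformiser $\pi$, residue field of cardinality $q$, normalised absolute value $|\cdot|$ and Haar measure $|dx|$ on $K$ with $\int_{O_K}|dx|=1$. Let $t\in K$ with $0<|t|<1$, let $E$ be the Tate elliptic curve with parameter $t$, and let $X=E(K)=K^\times/t^{\mathbb Z}$ be its compact one-dimensional $K$-analytic manifold of rational points. Let $\mathcal A$ be a finite analytic atlas of $X$ whose charts have distinct domains, whose nerve is connected, and which is equalising: for some $R$, each transition map takes every ball of radius at most $R$ contained in its domain to a ball of the same radius. A ball of $X$ is a subset of the domain of a chart of $\mathcal A$ which that chart maps onto a ball of $K$ of radius at most $R$. For $x,y\in X$ lying in a common ball, let $x\wedge y$ be the intersection of all balls containing $x$ and $y$. Let $\omega$ be a nowhere vanishing analytic differential $1$-form on $X$ and $\mu_\omega=|\omega|$ the associated measure, given in a chart $\phi$ in which $\omega=f_\phi\,dz$ by $\mu_\omega(A)=\int_{\phi(A)}|f_\phi(z)|\,|dz|$. For $s\in\mathbb R$ put $$\Delta_0^s u(x)=\int_X k_0(x,y)\,(u(x)-u(y))\,d\mu_\omega(y),\qquad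 k_0(x,y)=\begin{cases}\mu_\omega(x\wedge y)^{-s}&\text{if some ball contains $x$ and $y$,}\\1&\text{otherwise.}\end{cases}$$ Let $\chi$ be a continuous unitary additive character of $K$, trivial on $O_K$ and nontrivial on $\pi^{-1}O_K$. Let $\psi$ be a wavelet on $X$ supported on a ball $B$: in some chart $\phi\in\mathcal A$ whose domain contains $B$, with $\phi(B)=a+\pi^{-d}O_K$ of Haar measure $m$, one has $\psi(x)=m^{-1/2}\,\chi(\pi^{d-1}j\,\phi(x))$ for $x\in B$, with a unit $j\in O_K^\times$, and $\psi=0$ outside $B$. Assume that for every $x\in B$ there is a largest ball $U(x)$ of $X$ containing $x$. Let $i(X)$ be the Serre invariant of $X$, that is, the residue class modulo $q-1$ of any $r$ such that $X$ is analytically isomorphic to a disjoint union of $r$ copies of $O_K$ (such $r$ exist, and the class does not depend on $r$). Then $i(E(K))\equiv 0\bmod q-1$, and the eigenvalue $\lambda_\psi$ of $\psi$ satisfies $$\lambda_\psi\equiv i(E(K))\equiv 0\mod q-1$$ in the following sense, where congruences modulo $q-1$ are taken between rational numbers with denominator prime to $q-1$. 1. If $s\in\mathbb Z$ and $\Delta_0^s\psi=\lambda_\psi\psi$,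 then $\lambda_\psi$ is a rational number with denominator prime to $q-1$ and $\lambda_\psi\equiv i(E(K))\equiv0\bmod q-1$. 2. There are finitely many rational numbers $c_j$ and $m_j>0$ with denominators prime to $q-1$, not depending on $s$, with $m_j\equiv1\bmod q-1$ and $\sum_j c_j\equiv i(E(K))\equiv 0\bmod q-1$, such that for every $s\in\mathbb R$ with $\Delta_0^s\psi=\lambda_\psi(s)\psi$ one has $\lambda_\psi(s)=\sum_j c_j\,m_j^{-s}$. (So $\lambda_\psi(s)$ reduces to $\sum_j c_j\cdot 1^{-s}\equiv 0$.) 3. If $|f_\phi|$ is constant on $\phi(B)$ (as is the case for all small enough $B$), then $\psi$ is an eigenfunction of $\Delta_0^s$ for every $s\in\mathbb R$. -/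

import Mathlib

open MeasureTheory Metric Set Topology
open scoped ENNReal NNReal ContDiff Manifold NormedField Valued Pointwise

noncomputable section

/-! ### The local field -/

/-- The cardinality `q` of the residue field of `K`. -/
def residueCard (K : Type*) [NontriviallyNormedField K] [IsUltrametricDist K] : ℕ :=
  Nat.card 𝓀[K]

/-- The Haar measure `|dx|` on `K`, normalised so that the ring of integers (the closed unit ball)
has measure one. -/
def haarK (K : Type*) [NontriviallyNormedField K] [ProperSpace K]
    [MeasurableSpace K] [BorelSpace K] : Measure K :=
  Measure.addHaarMeasure
    { carrier := closedBall (0 : K) 1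
      isCompact' := isCompact_closedBall 0 1
      interior_nonempty' :=
        ⟨0, interior_mono ball_subset_closedBall
          (by rw [isOpen_ball.interior_eq]; exact mem_ball_self one_pos)⟩ }

/-- The normalised absolute value of `K`: the factor by which multiplication with `a` scales the
Haar measure, that is, the volume of `a · O_K`. -/
def normAbs {K : Type*} [NontriviallyNormedField K] [ProperSpace K]
    [MeasurableSpace K] [BorelSpace K] (a : K) : ℝ≥0∞ :=
  haarK K (a • closedBall (0 : K) 1)

/-! ### One-dimensional analytic manifolds over `K` -/

section Manifold

variable (K : Type*) [NontriviallyNormedField K] (X : Type*) [TopologicalSpace X]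
  [ChartedSpace K X]

/-- The charts of the maximal analytic atlas of `X`. -/
abbrev analyticCharts : Set (OpenPartialHomeomorph X K) :=
  IsManifold.maximalAtlas 𝓘(K, K) ω X

/-- `X` is isomorphic, as an analytic manifold, to the disjoint union of `r` copies of the closed
unit ball `O_K`: it is partitioned by the domains of `r` analytic charts, each of which has image
`O_K`. -/
def IsDisjointUnionOfUnitBalls (r : ℕ) : Prop :=
  ∃ e : Fin r → OpenPartialHomeomorph X K,
    (∀ j, e j ∈ analyticCharts K X ∧ (e j).target = closedBall (0 : K) 1) ∧
    Pairwise (fun j l => Disjoint (e j).source (e l).source) ∧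
    (⋃ j, (e j).source) = univ

/-- The residue class `i` modulo `q - 1` is the Serre invariant of `X`: the manifold is a disjoint
union of `r` copies of `O_K` for at least one `r`, and `r ≡ i` modulo `q - 1` for every such `r`. -/
def HasSerreInvariant [IsUltrametricDist K] (i : ZMod (residueCard K - 1)) : Prop :=
  (∃ r : ℕ, IsDisjointUnionOfUnitBalls K X r) ∧
    ∀ r : ℕ, IsDisjointUnionOfUnitBalls K X r → (r : ZMod (residueCard K - 1)) = i

/-- An analytic differential `1`-form on `X`: for every analytic chart `φ` an analytic function
`f_φ` on its image, so that the `f_φ(z) dz` agree under changes of charts. (The values of `f_φ`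
outside the image of `φ` carry no meaning.) -/
structure AnalyticOneForm where
  /-- the coefficient `f_φ` of the form in the chart `φ` -/
  coeff : OpenPartialHomeomorph X K → K → K
  analytic : ∀ φ ∈ analyticCharts K X, AnalyticOnNhd K (coeff φ) φ.target
  compatible : ∀ φ ∈ analyticCharts K X, ∀ ψ ∈ analyticCharts K X,
    ∀ x ∈ φ.source ∩ ψ.source,
      coeff φ (φ x) = coeff ψ (ψ x) * deriv (fun z => ψ (φ.symm z)) (φ x)

variable {K X}

namespace AnalyticOneForm

/-- The form has no zero. -/
def NowhereVanishing (η : AnalyticOneForm K X) : Prop :=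
  ∀ φ ∈ analyticCharts K X, ∀ z ∈ φ.target, η.coeff φ z ≠ 0

variable [ProperSpace K] [MeasurableSpace K] [BorelSpace K] [MeasurableSpace X]

/-- `μ` is given in every analytic chart `φ` by `∫_{φ(A)} |f_φ(z)| |dz|`. -/
def IsVolume (η : AnalyticOneForm K X) (μ : Measure X) : Prop :=
  ∀ φ ∈ analyticCharts K X, ∀ A : Set X, MeasurableSet A → A ⊆ φ.source →
    μ A = ∫⁻ z in φ '' A, normAbs (η.coeff φ z) ∂(haarK K)

open Classical in
/-- The measure `|η|` on `X`: the one which is given in every analytic chart `φ` by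
`∫_{φ(A)} |f_φ(z)| |dz|`. -/
def measure (η : AnalyticOneForm K X) : Measure X :=
  if h : ∃ μ : Measure X, η.IsVolume μ then h.choose else 0

end AnalyticOneForm

end Manifold

/-! ### Balls, the join of two points, and the operator -/

section Operator

variable {K : Type*} [NontriviallyNormedField K] {X : Type*} [TopologicalSpace X]

/-- `𝒜` is a finite equalising atlas of `X` with connected nerve: a finite set of analytic charts
covering `X`, distinct charts having distinct domains; any two charts are joined by a
chain of charts in which consecutive domains meet; and the transition maps take balls of
radius at most `R` (that is, sufficiently small balls) to balls of the same radius. -/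
structure IsEqualisingAtlas [ChartedSpace K X] (𝒜 : Set (OpenPartialHomeomorph X K)) (R : ℝ) :
    Prop where
  finite : 𝒜.Finite
  analytic : 𝒜 ⊆ analyticCharts K X
  cover : (⋃ φ ∈ 𝒜, φ.source) = univ
  distinct : InjOn (fun φ : OpenPartialHomeomorph X K => φ.source) 𝒜
  connected : ∀ φ ∈ 𝒜, ∀ ψ ∈ 𝒜,
    Relation.ReflTransGen (fun α β => β ∈ 𝒜 ∧ (α.source ∩ β.source).Nonempty) φ ψ
  equalising : ∀ φ ∈ 𝒜, ∀ ψ ∈ 𝒜, ∀ (a : K) (r : ℝ), 0 < r → r ≤ R →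
    closedBall a r ⊆ φ '' (φ.source ∩ ψ.source) →
      ∃ b : K, (fun z => ψ (φ.symm z)) '' closedBall a r = closedBall b r

/-- `B` is a ball of `X`: it lies in the domain of a chart of `𝒜`, which maps it onto a ball
of `K` of radius at most `R`. -/
def IsBall (𝒜 : Set (OpenPartialHomeomorph X K)) (R : ℝ) (B : Set X) : Prop :=
  ∃ φ ∈ 𝒜, ∃ (a : K) (r : ℝ), 0 < r ∧ r ≤ R ∧ B ⊆ φ.source ∧ φ '' B = closedBall a r

/-- `U` is the largest ball of `X` that contains `x`. -/
def IsLargestBall (𝒜 : Set (OpenPartialHomeomorph X K)) (R : ℝ) (x : X) (U : Set X) : Prop :=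
  IsBall 𝒜 R U ∧ x ∈ U ∧ ∀ B, IsBall 𝒜 R B → x ∈ B → B ⊆ U

/-- Some ball of `X` contains both `x` and `y`, so that the join of `x` and `y` exists. -/
def JoinExists (𝒜 : Set (OpenPartialHomeomorph X K)) (R : ℝ) (x y : X) : Prop :=
  ∃ B, IsBall 𝒜 R B ∧ x ∈ B ∧ y ∈ B

/-- The join `x ∧ y`: the intersection of all balls of `X` that contain both `x` and `y`. -/
def join (𝒜 : Set (OpenPartialHomeomorph X K)) (R : ℝ) (x y : X) : Set X :=
  ⋂₀ {B | IsBall 𝒜 R B ∧ x ∈ B ∧ y ∈ B}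

variable [MeasurableSpace X]

open Classical in
/-- The kernel function `k₀(x,y)`, equal to `μ(x ∧ y)^(-s)` if the join exists, and to `1`
otherwise. -/
def kernelZero (𝒜 : Set (OpenPartialHomeomorph X K)) (R : ℝ) (μ : Measure X) (s : ℝ)
    (x y : X) : ℝ :=
  if JoinExists 𝒜 R x y then (μ.real (join 𝒜 R x y)) ^ (-s) else 1

/-- The operator `Δ₀^s u(x) = ∫ k₀(x,y) (u(x) - u(y)) dμ(y)`. -/
def laplaceZero (𝒜 : Set (OpenPartialHomeomorph X K)) (R : ℝ) (μ : Measure X) (s : ℝ)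
    (u : X → ℂ) (x : X) : ℂ :=
  ∫ y, (kernelZero 𝒜 R μ s x y : ℂ) * (u x - u y) ∂μ

/-- `Δ₀^s u = lam · u`. -/
def HasWaveletEigenvalue (𝒜 : Set (OpenPartialHomeomorph X K)) (R : ℝ) (μ : Measure X) (s : ℝ)
    (u : X → ℂ) (lam : ℂ) : Prop :=
  ∀ x, laplaceZero 𝒜 R μ s u x = lam * u x

end Operator

/-! ### Wavelets -/

section Wavelet

variable {K : Type*} [NontriviallyNormedField K] [IsUltrametricDist K]

/-- A unitary additive character of `K`, continuous, trivial on `O_K` and nontrivial on `ϖ⁻¹ O_K`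
for the uniformisers `ϖ`. -/
def IsStandardCharacter (χ : AddChar K Circle) : Prop :=
  Continuous χ ∧ (∀ z : K, ‖z‖ ≤ 1 → χ z = 1) ∧
    ∀ ϖ : 𝒪[K], Irreducible ϖ → ∃ z : K, ‖z‖ ≤ 1 ∧ χ ((ϖ : K)⁻¹ * z) ≠ 1

variable {X : Type*} [TopologicalSpace X] [ProperSpace K] [MeasurableSpace K] [BorelSpace K]

/-- `u` is a wavelet on `X` with support the ball `B`: in the chart `φ` of `𝒜`, whose domain
contains `B`, it is the Kozyrev wavelet
`μ(D)^(-1/2) · χ(ϖ^(d-1) j z) · 1_D(z)` of a ball `D = φ(B) = a + ϖ^(-d) O_K` of `K`, where `j` is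
a unit of `O_K`. -/
def IsWavelet (𝒜 : Set (OpenPartialHomeomorph X K)) (R : ℝ) (χ : AddChar K Circle)
    (ϖ : 𝒪[K]) (φ : OpenPartialHomeomorph X K) (B : Set X) (u : X → ℂ) : Prop :=
  φ ∈ 𝒜 ∧ B ⊆ φ.source ∧
    ∃ (a : K) (d : ℤ) (j : K), ‖j‖ = 1 ∧ ‖(ϖ : K) ^ (-d)‖ ≤ R ∧
      φ '' B = closedBall a ‖(ϖ : K) ^ (-d)‖ ∧
      u = B.indicator (fun x =>
        ((((haarK K).real (φ '' B)) ^ (-(1 / 2) : ℝ) : ℝ) : ℂ) *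
          (χ ((ϖ : K) ^ (d - 1) * j * φ x) : ℂ))

end Wavelet

/-! ### Congruences modulo `N` -/

/-- The real number `x` is a fraction with denominator prime to `N`, and `x ≡ i` modulo `N`. -/
def CongrMod (N : ℕ) (x : ℝ) (i : ZMod N) : Prop :=
  ∃ (a : ℤ) (b : ℕ), 0 < b ∧ b.Coprime N ∧ x = (a : ℝ) / (b : ℝ) ∧
    (a : ZMod N) = (b : ZMod N) * i

/-- The function `F` of the real variable `s` is congruent to `i` modulo `N` as an exponential
sum: `F(s) = ∑ c_j m_j^(-s)`, with fractions `c_j` and `m_j > 0` with denominators prime to `N`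
for which `m_j ≡ 1` and `∑ c_j · 1^(-s) = ∑ c_j ≡ i` modulo `N`. -/
def ExpSumCongrMod (N : ℕ) (F : ℝ → ℝ) (i : ZMod N) : Prop :=
  ∃ (n : ℕ) (c m : Fin n → ℝ) (γ : Fin n → ZMod N),
    (∀ j, CongrMod N (c j) (γ j)) ∧ (∀ j, 0 < m j ∧ CongrMod N (m j) 1) ∧
    (∀ s : ℝ, F s = ∑ j, c j * (m j) ^ (-s)) ∧ ∑ j, γ j = i

/-! ### The Tate curve -/

/-- The parameters of Tate curves over `K`: the `t ∈ K` with `0 < |t| < 1`. -/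
structure TateParameter (K : Type*) [NontriviallyNormedField K] where
  /-- the parameter, a nonzero element of `K` -/
  val : Kˣ
  norm_lt_one : ‖(val : K)‖ < 1

section Tate

variable {K : Type*} [NontriviallyNormedField K]

/-- The set `E(K) = Kˣ / t^ℤ` of `K`-rational points of the Tate elliptic curve with
parameter `t`. -/
def TateCurve (t : TateParameter K) : Type _ := Kˣ ⧸ Subgroup.zpowers t.val

namespace TateCurve

variable (t : TateParameter K)

/-- The quotient map `Kˣ → E(K)`. -/
def mk (v : Kˣ) : TateCurve t := (QuotientGroup.mk v : Kˣ ⧸ Subgroup.zpowers t.val)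

instance : CommGroup (TateCurve t) :=
  inferInstanceAs (CommGroup (Kˣ ⧸ Subgroup.zpowers t.val))

instance : TopologicalSpace (TateCurve t) :=
  inferInstanceAs (TopologicalSpace (Kˣ ⧸ Subgroup.zpowers t.val))

instance : MeasurableSpace (TateCurve t) := borel _

instance : BorelSpace (TateCurve t) := ⟨rfl⟩

theorem continuous_mk : Continuous (mk t) := continuous_quot_mk

theorem isOpenMap_mk : IsOpenMap (mk t) := QuotientGroup.isOpenMap_coe

theorem mk_eq_mk {v w : Kˣ} : mk t v = mk t w ↔ ∃ n : ℤ, w = v * t.val ^ n := by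
  have h : mk t v = mk t w ↔ v⁻¹ * w ∈ Subgroup.zpowers t.val := QuotientGroup.eq
  rw [h, Subgroup.mem_zpowers_iff]
  exact exists_congr fun n => by rw [eq_inv_mul_iff_mul_eq]; exact eq_comm

/-- A chart of `E(K)` that is a local inverse of the quotient map `Kˣ → E(K)`. -/
def IsUniformising (ξ : OpenPartialHomeomorph (TateCurve t) K) : Prop :=
  ∀ x ∈ ξ.source, ∃ v : Kˣ, (v : K) = ξ x ∧ mk t v = x

theorem norm_zpow_eq_one {n : ℤ} (h : ‖(t.val : K)‖ ^ n = 1) : n = 0 := by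
  have h0 : 0 < ‖(t.val : K)‖ := norm_pos_iff.2 t.val.ne_zero
  exact (zpow_eq_one_iff_right₀ h0.le t.norm_lt_one.ne).1 h

theorem norm_eq_of_near [IsUltrametricDist K] {v w : K} (h : ‖w - v‖ < ‖v‖) : ‖w‖ = ‖v‖ := by
  have h' : ‖w + -v‖ < max ‖w‖ ‖-v‖ := by
    rw [← sub_eq_add_neg, norm_neg]
    exact lt_max_of_lt_right h
  simpa using IsUltrametricDist.norm_eq_of_add_norm_lt_max h'

theorem exists_isUniformising [IsUltrametricDist K] (v : Kˣ) :
    ∃ ξ : OpenPartialHomeomorph (TateCurve t) K, IsUniformising t ξ ∧ mk t v ∈ ξ.source := by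
  let S : Set Kˣ := {w | ‖(w : K) - v‖ < ‖(v : K)‖}
  have hS : IsOpen S :=
    isOpen_lt ((Units.continuous_val.sub continuous_const).norm) continuous_const
  have hvS : v ∈ S := by simp [S]
  have hinj : InjOn (mk t) S := by
    intro a ha b hb hab
    obtain ⟨n, rfl⟩ := (mk_eq_mk t).1 hab
    have h1 := norm_eq_of_near ha
    have h2 := norm_eq_of_near hb
    have h3 : ‖(t.val : K)‖ ^ n = 1 := by
      have : ‖(a : K)‖ * ‖(t.val : K)‖ ^ n = ‖(a : K)‖ * 1 := by
        rw [mul_one, ← norm_zpow, ← norm_mul, h1, ← h2]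
        simp
      exact mul_left_cancel₀ (norm_ne_zero_iff.2 a.ne_zero) this
    simp [norm_zpow_eq_one t h3]
  have : Nonempty Kˣ := ⟨1⟩
  let e : OpenPartialHomeomorph Kˣ (TateCurve t) :=
    OpenPartialHomeomorph.ofContinuousOpen (hinj.toPartialEquiv (mk t) S)
      (continuous_mk t).continuousOn (isOpenMap_mk t) hS
  let i : OpenPartialHomeomorph Kˣ K :=
    (Units.isOpenEmbedding_val (R := K)).toOpenPartialHomeomorph _
  refine ⟨e.symm.trans i, ?_, ?_⟩
  · intro x hx
    have hx' : x ∈ e.target := by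
      have := hx
      rw [OpenPartialHomeomorph.trans_source] at this
      exact this.1
    exact ⟨e.symm x, rfl, e.right_inv hx'⟩
  · rw [OpenPartialHomeomorph.trans_source]
    exact ⟨e.map_source hvS, by simp [i]⟩

theorem exists_chart [IsUltrametricDist K] (x : TateCurve t) :
    ∃ ξ : OpenPartialHomeomorph (TateCurve t) K, IsUniformising t ξ ∧ x ∈ ξ.source := by
  obtain ⟨v, rfl⟩ : ∃ v, mk t v = x := QuotientGroup.mk_surjective (s := Subgroup.zpowers t.val) x
  exact exists_isUniformising t v

/-- The analytic structure of `E(K)` is the one induced from `Kˣ ⊆ K`: its charts are the local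
inverses of the quotient map. -/
instance [IsUltrametricDist K] : ChartedSpace K (TateCurve t) where
  atlas := {ξ | IsUniformising t ξ}
  chartAt x := (exists_chart t x).choose
  mem_chart_source x := (exists_chart t x).choose_spec.2
  chart_mem_atlas x := (exists_chart t x).choose_spec.1

instance [IsUltrametricDist K] : IsManifold 𝓘(K, K) ω (TateCurve t) := by
  apply isManifold_of_contDiffOn
  intro ξ ζ hξ hζ
  have hξ : IsUniformising t ξ := hξ
  have hζ : IsUniformising t ζ := hζ
  simp only [modelWithCornersSelf_coe, modelWithCornersSelf_coe_symm, Function.comp_id,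
    Function.id_comp, range_id, inter_univ, preimage_id]
  intro z hz
  have hopen : IsOpen (ξ.symm.trans ζ).source := (ξ.symm.trans ζ).open_source
  have key : ∀ y ∈ (ξ.symm.trans ζ).source, y ≠ 0 ∧ ∃ n : ℤ, ζ (ξ.symm y) = y * (t.val : K) ^ n := by
    intro y hy
    rw [OpenPartialHomeomorph.trans_source] at hy
    have hy1 : y ∈ ξ.target := hy.1
    have hy2 : ξ.symm y ∈ ζ.source := hy.2
    obtain ⟨v, hv, hv'⟩ := hξ _ (ξ.map_target hy1)
    obtain ⟨w, hw, hw'⟩ := hζ _ hy2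
    rw [ξ.right_inv hy1] at hv
    obtain ⟨n, hn⟩ := (mk_eq_mk t).1 (hv'.trans hw'.symm)
    refine ⟨hv ▸ v.ne_zero, n, ?_⟩
    rw [← hw, ← hv, hn]
    simp
  have hcont : ContinuousOn (ξ.symm.trans ζ) (ξ.symm.trans ζ).source :=
    (ξ.symm.trans ζ).continuousOn
  obtain ⟨hz0, n, hn⟩ := key z hz
  have ht0 : 0 < ‖(t.val : K)‖ := norm_pos_iff.2 t.val.ne_zero
  -- near `z` the norms of `y` and of its image are constant, hence so is the exponent
  have h1 : ∀ᶠ y in 𝓝 z, ‖y‖ = ‖z‖ := by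
    filter_upwards [ball_mem_nhds z (norm_pos_iff.2 hz0)] with y hy
    exact norm_eq_of_near
      (by rw [mem_ball, dist_eq_norm] at hy; exact hy)
  have hat : ContinuousAt (ξ.symm.trans ζ) z := hcont.continuousAt (hopen.mem_nhds hz)
  have hne : (ξ.symm.trans ζ) z ≠ 0 := by
    change ζ (ξ.symm z) ≠ 0
    rw [hn]
    exact mul_ne_zero hz0 (zpow_ne_zero _ t.val.ne_zero)
  have h2 : ∀ᶠ y in 𝓝 z, ‖(ξ.symm.trans ζ) y‖ = ‖(ξ.symm.trans ζ) z‖ := by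
    filter_upwards [hat (ball_mem_nhds _ (norm_pos_iff.2 hne))] with y hy
    exact norm_eq_of_near
      (by rw [mem_preimage, mem_ball, dist_eq_norm] at hy; exact hy)
  have h3 : (ξ.symm.trans ζ) =ᶠ[𝓝 z] fun y => y * (t.val : K) ^ n := by
    filter_upwards [h1, h2, hopen.mem_nhds hz] with y hy1 hy2 hy3
    obtain ⟨-, l, hl⟩ := key y hy3
    change ζ (ξ.symm y) = _
    change ‖ζ (ξ.symm y)‖ = ‖ζ (ξ.symm z)‖ at hy2
    rw [hl, hn, norm_mul, norm_mul, hy1, norm_zpow, norm_zpow] at hy2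
    have h4 := mul_left_cancel₀ (norm_ne_zero_iff.2 hz0) hy2
    rw [hl, zpow_right_injective₀ ht0 t.norm_lt_one.ne h4]
  have h5 : ContDiffAt K ω (fun y => y * (t.val : K) ^ n) z := contDiffAt_id.mul contDiffAt_const
  exact (h5.congr_of_eventuallyEq h3).contDiffWithinAt

end TateCurve

end Tate

end

/-! Everything rests on `q ≡ 1` modulo `q - 1`. A nowhere vanishing analytic function has a locally
constant absolute value, which is a power of `q`. Its integral over a ball is found by cutting the
ball repeatedly into `q` smaller ones: the final pieces contribute powers of `q`, and `q` numbers
congruent to 1 add up to a number congruent to 1 (`isUnitVolume_lintegral`). Hence every ball in a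
chart has volume congruent to 1, and a disjoint union of `r` copies of `O_K` has volume congruent to
`r` (`AnalyticOneForm.IsVolume.exists_univ`). The volume does not know the decomposition, so the
class of `r` is well defined. If `|t| = |π|^n`, then `E(K)` consists of `n` shells of constant
absolute value with `q - 1` balls in each, so `r = n(q - 1) ≡ 0`
(`TateCurve.exists_isDisjointUnionOfUnitBalls`).

For the eigenvalue, transition maps preserve radii and the points of `B` share one largest ball `U`,
so the balls through a point of `B` form a chain (`IsBallTower`). Write its part from `B` to `U` as
`B = B_0 ⊂ ... ⊂ B_n = U`. The kernel is constant on each layer between neighbours of this chain and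
is 1 off `U`. Inside `B` only pairs with join `B` matter, as `ψ` is constant on the next smaller
balls. So for `x ∈ B` one gets `Δψ(x) = λ ψ(x) - μ(B)^(-s) ∫ψ` with `λ = μ(B) μ(B)^(-s) + ∑
μ(B_{i+1})^(-s) (μ(B_{i+1}) - μ(B_i)) + μ(Uᶜ)`. Comparing two points of `B` at which `ψ` differs
shows that any eigenvalue equals `λ`, even if `∫ψ ≠ 0` (`IsBallTower.eigenvalue_eq`). If `|f_φ|` is
constant on `φ(B)`, then `∫ψ = 0` and `ψ` is an eigenfunction. The coefficients in `λ` are congruent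
to 1, to 0 for each layer, and to `i - 1` for `Uᶜ`; they sum to `i`. -/

noncomputable section

/-! ### Arithmetic of congruences between fractions -/

namespace CongrMod

variable {N : ℕ} {x y : ℝ} {i j : ZMod N}

theorem intCast (N : ℕ) (a : ℤ) : CongrMod N a (a : ZMod N) :=
  ⟨a, 1, one_pos, Nat.coprime_one_left N, by simp, by simp⟩

theorem natCast (N : ℕ) (a : ℕ) : CongrMod N a (a : ZMod N) := by
  simpa using intCast N a

theorem zero (N : ℕ) : CongrMod N 0 0 := by simpa using natCast N 0

theorem one (N : ℕ) : CongrMod N 1 1 := by simpa using natCast N 1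

theorem add (hx : CongrMod N x i) (hy : CongrMod N y j) : CongrMod N (x + y) (i + j) := by
  obtain ⟨a, b, hb, hbN, rfl, h⟩ := hx
  obtain ⟨c, d, hd, hdN, rfl, h'⟩ := hy
  refine ⟨a * d + b * c, b * d, Nat.mul_pos hb hd, hbN.mul_left hdN, ?_, ?_⟩
  · have : (b : ℝ) ≠ 0 := by positivity
    have : (d : ℝ) ≠ 0 := by positivity
    push_cast
    field_simp
  · push_cast
    rw [h, h']
    ring

theorem mul (hx : CongrMod N x i) (hy : CongrMod N y j) : CongrMod N (x * y) (i * j) := by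
  obtain ⟨a, b, hb, hbN, rfl, h⟩ := hx
  obtain ⟨c, d, hd, hdN, rfl, h'⟩ := hy
  refine ⟨a * c, b * d, Nat.mul_pos hb hd, hbN.mul_left hdN, ?_, ?_⟩
  · have : (b : ℝ) ≠ 0 := by positivity
    have : (d : ℝ) ≠ 0 := by positivity
    push_cast
    field_simp
  · push_cast
    rw [h, h']
    ring

theorem neg (hx : CongrMod N x i) : CongrMod N (-x) (-i) := by
  simpa using (intCast N (-1)).mul hx

theorem sub (hx : CongrMod N x i) (hy : CongrMod N y j) : CongrMod N (x - y) (i - j) := by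
  simpa [sub_eq_add_neg] using hx.add hy.neg

theorem sum {ι : Type*} (s : Finset ι) {f : ι → ℝ} {g : ι → ZMod N}
    (h : ∀ a ∈ s, CongrMod N (f a) (g a)) : CongrMod N (∑ a ∈ s, f a) (∑ a ∈ s, g a) := by
  classical
  induction s using Finset.induction_on with
  | empty => simpa using zero N
  | insert a s ha ih =>
    rw [Finset.sum_insert ha, Finset.sum_insert ha]
    exact (h a (Finset.mem_insert_self a s)).add
      (ih fun b hb => h b (Finset.mem_insert_of_mem hb))

/-- Denominators prime to `N` are units in `ZMod N`, so the cross-multiplied identity can be divided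
by them. This is what makes the Serre invariant well defined. -/
theorem unique (hx : CongrMod N x i) (hy : CongrMod N x j) : i = j := by
  obtain ⟨a, b, hb, hbN, rfl, h⟩ := hx
  obtain ⟨c, d, hd, hdN, e, h'⟩ := hy
  have e' : a * d = c * b := by
    have h1 : (b : ℝ) ≠ 0 := by positivity
    have h2 : (d : ℝ) ≠ 0 := by positivity
    rw [div_eq_div_iff h1 h2] at e
    exact_mod_cast e
  have e'' : (a : ZMod N) * d = c * b := by exact_mod_cast congrArg (Int.cast : ℤ → ZMod N) e'
  have hu := ((ZMod.isUnit_iff_coprime b N).2 hbN).mul ((ZMod.isUnit_iff_coprime d N).2 hdN)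
  refine hu.mul_left_cancel ?_
  rw [h, h'] at e''
  linear_combination e''

/-- The numerator is congruent to the denominator, hence also prime to `N`, and positivity lets it
serve as the new denominator. -/
theorem inv (hx : CongrMod N x 1) (h0 : 0 < x) : CongrMod N x⁻¹ 1 := by
  obtain ⟨a, b, hb, hbN, rfl, h⟩ := hx
  have hb' : (0 : ℝ) < b := by exact_mod_cast hb
  have ha : 0 < a := by
    have := (div_pos_iff_of_pos_right hb').1 h0
    exact_mod_cast this
  lift a to ℕ using ha.le
  refine ⟨b, a, by exact_mod_cast ha, ?_, by simp, ?_⟩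
  · rw [← ZMod.isUnit_iff_coprime]
    have : (a : ZMod N) = b := by simpa using h
    rw [this]
    exact (ZMod.isUnit_iff_coprime b N).2 hbN
  · simpa using h.symm

theorem pow (hx : CongrMod N x 1) (n : ℕ) : CongrMod N (x ^ n) 1 := by
  induction n with
  | zero => simpa using one N
  | succ n ih => simpa [pow_succ] using ih.mul hx

theorem zpow (hx : CongrMod N x 1) (h0 : 0 < x) (n : ℤ) : CongrMod N (x ^ n) 1 := by
  cases n with
  | ofNat n => simpa using hx.pow n
  | negSucc n => simpa [zpow_negSucc] using (hx.pow (n + 1)).inv (pow_pos h0 _)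

end CongrMod

/-- At an integral exponent, an exponential sum congruent to `i` takes a value congruent to `i`. -/
theorem ExpSumCongrMod.congrMod {N : ℕ} {F : ℝ → ℝ} {i : ZMod N} (hF : ExpSumCongrMod N F i)
    (s : ℤ) : CongrMod N (F s) i := by
  obtain ⟨n, c, m, γ, hc, hm, h, rfl⟩ := hF
  rw [h]
  refine CongrMod.sum _ fun j _ => ?_
  -- Only for integral `s` is the real power `m_j ^ (-s)` a fraction; it is then congruent to 1 like
  -- its base.
  have := (hc j).mul ((hm j).2.zpow (hm j).1 (-s))
  rw [mul_one, ← Real.rpow_intCast] at this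
  simpa using this

/-! ### Uniformisers and balls of a local field -/

/-- `π` generates the maximal ideal of the ring of integers. -/
structure IsUniformiser {K : Type*} [NontriviallyNormedField K] (π : K) : Prop where
  pos : 0 < ‖π‖
  lt_one : ‖π‖ < 1
  norm_le : ∀ x : K, ‖x‖ < 1 → ‖x‖ ≤ ‖π‖

/-- An `x` with `‖ϖ‖ < ‖x‖ < 1` would give the factorisation `ϖ = x * (ϖ / x)` into two non-units.
-/
theorem Irreducible.isUniformiser {K : Type*} [NontriviallyNormedField K] [IsUltrametricDist K]
    {ϖ : 𝒪[K]} (h : Irreducible ϖ) : IsUniformiser (ϖ : K) := by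
  have h0 : 0 < ‖(ϖ : K)‖ := norm_pos_iff.2 fun h' => h.ne_zero (Subtype.ext h')
  refine ⟨h0, Valued.integer.norm_irreducible_lt_one h, fun x hx => ?_⟩
  by_contra! hlt
  have hx0 : 0 < ‖x‖ := h0.trans hlt
  have hx1 : x ∈ 𝒪[K] := Valued.integer.mem_iff.2 hx.le
  have hy : ‖(ϖ : K) / x‖ < 1 := by rwa [norm_div, div_lt_one hx0]
  have hy1 : (ϖ : K) / x ∈ 𝒪[K] := Valued.integer.mem_iff.2 hy.le
  have he : ϖ = (⟨x, hx1⟩ : 𝒪[K]) * ⟨(ϖ : K) / x, hy1⟩ := by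
    apply Subtype.ext
    change (ϖ : K) = x * (ϖ / x)
    rw [mul_div_cancel₀ _ (norm_pos_iff.1 hx0)]
  rcases h.isUnit_or_isUnit he with hu | hu
  · exact hx.ne (Valued.integer.isUnit_iff_norm_eq_one.1 hu)
  · exact hy.ne (Valued.integer.isUnit_iff_norm_eq_one.1 hu)

namespace IsUniformiser

variable {K : Type*} [NontriviallyNormedField K] {π : K}

theorem ne_zero (hπ : IsUniformiser π) : π ≠ 0 := norm_pos_iff.1 hπ.pos

theorem zpow_pos (hπ : IsUniformiser π) (k : ℤ) : 0 < ‖π‖ ^ k := _root_.zpow_pos hπ.pos k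

theorem zpow_le_zpow (hπ : IsUniformiser π) {k l : ℤ} : ‖π‖ ^ k ≤ ‖π‖ ^ l ↔ l ≤ k :=
  zpow_le_zpow_iff_right_of_lt_one₀ hπ.pos hπ.lt_one

theorem exists_zpow_bracket (hπ : IsUniformiser π) {r : ℝ} (hr : 0 < r) :
    ∃ k : ℤ, ‖π‖ ^ k ≤ r ∧ r < ‖π‖ ^ (k - 1) := by
  obtain ⟨n, hn, hn'⟩ := exists_mem_Ico_zpow hr ((one_lt_inv₀ hπ.pos).2 hπ.lt_one)
  refine ⟨-n, by simpa [zpow_neg, inv_zpow] using hn, ?_⟩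
  rw [show -n - 1 = -(n + 1) by ring]
  simpa [zpow_neg, inv_zpow] using hn'

/-- A norm that is smaller than `‖π‖ ^ (k - 1)` is at most `‖π‖ ^ k`. -/
theorem norm_le_zpow (hπ : IsUniformiser π) {x : K} {k : ℤ} (h : ‖x‖ < ‖π‖ ^ (k - 1)) :
    ‖x‖ ≤ ‖π‖ ^ k := by
  have hk := hπ.zpow_pos (k - 1)
  have h1 := hπ.norm_le (x / π ^ (k - 1)) (by rwa [norm_div, norm_zpow, div_lt_one hk])
  rw [norm_div, norm_zpow, div_le_iff₀ hk] at h1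
  refine h1.trans_eq ?_
  rw [← zpow_one_add₀ hπ.pos.ne']
  congr 1
  ring

theorem norm_eq_zpow (hπ : IsUniformiser π) {x : K} (hx : x ≠ 0) : ∃ k : ℤ, ‖x‖ = ‖π‖ ^ k := by
  obtain ⟨k, h1, h2⟩ := hπ.exists_zpow_bracket (norm_pos_iff.2 hx)
  exact ⟨k, (hπ.norm_le_zpow h2).antisymm h1⟩

/-- The value group is discrete, so real radii can be traded for integral exponents. -/
theorem exists_closedBall_eq (hπ : IsUniformiser π) {r : ℝ} (hr : 0 < r) :
    ∃ k : ℤ, ‖π‖ ^ k ≤ r ∧ ∀ a : K, closedBall a r = closedBall a (‖π‖ ^ k) := by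
  obtain ⟨k, h1, h2⟩ := hπ.exists_zpow_bracket hr
  refine ⟨k, h1, fun a => (closedBall_subset_closedBall h1).antisymm' fun x hx => ?_⟩
  rw [mem_closedBall, dist_eq_norm] at hx ⊢
  exact hπ.norm_le_zpow (hx.trans_lt h2)

theorem add_zpow_mem_closedBall (π a : K) (k : ℤ) :
    a + π ^ k ∈ closedBall a (‖π‖ ^ k) := by
  simp [mem_closedBall, dist_eq_norm]

/-- The point `a + π ^ k` has distance exactly `‖π‖ ^ k` from `a`, so a ball determines its
exponent. -/
theorem closedBall_subset_iff (hπ : IsUniformiser π) {a : K} {k l : ℤ} :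
    closedBall a (‖π‖ ^ k) ⊆ closedBall a (‖π‖ ^ l) ↔ l ≤ k := by
  refine ⟨fun h => ?_, fun h => closedBall_subset_closedBall (hπ.zpow_le_zpow.2 h)⟩
  have := h (add_zpow_mem_closedBall π a k)
  rw [mem_closedBall, dist_eq_norm, add_sub_cancel_left, norm_zpow] at this
  exact hπ.zpow_le_zpow.1 this

theorem isOpen_closedBall [IsUltrametricDist K] (hπ : IsUniformiser π) (a : K) (k : ℤ) :
    IsOpen (closedBall a (‖π‖ ^ k)) :=
  IsUltrametricDist.isOpen_closedBall a (hπ.zpow_pos k).ne'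

end IsUniformiser

/-- By the ultrametric inequality, the norm on `K` is locally constant away from zero. -/
theorem eventually_norm_eq {T K : Type*} [TopologicalSpace T] [NontriviallyNormedField K]
    [IsUltrametricDist K] {f : T → K} {x : T} (hf : ContinuousAt f x) (h0 : f x ≠ 0) :
    ∀ᶠ y in 𝓝 x, ‖f y‖ = ‖f x‖ := by
  filter_upwards [hf (ball_mem_nhds (f x) (norm_pos_iff.2 h0))] with y hy
  rw [mem_preimage, mem_ball, dist_eq_norm] at hy
  exact TateCurve.norm_eq_of_near hy

/-! ### Residue classes and the subdivision of a ball into `q` smaller ones -/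

section Residues

variable (K : Type*) [NontriviallyNormedField K] [IsUltrametricDist K]

/-- A representative in `O_K` of a residue class. -/
def residueRep (i : 𝓀[K]) : K :=
  ((IsLocalRing.residue_surjective (R := 𝒪[K]) i).choose : 𝒪[K])

variable {K}

theorem norm_residueRep_le (i : 𝓀[K]) : ‖residueRep K i‖ ≤ 1 :=
  Valued.integer.norm_le_one (K := K) _

theorem norm_lt_one_iff_residue_eq_zero (z : 𝒪[K]) :
    ‖(z : K)‖ < 1 ↔ IsLocalRing.residue 𝒪[K] z = 0 := by
  rw [IsLocalRing.residue_eq_zero_iff, IsLocalRing.mem_maximalIdeal, mem_nonunits_iff,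
    Valued.integer.isUnit_iff_norm_eq_one]
  exact ⟨fun h => h.ne, fun h => lt_of_le_of_ne (Valued.integer.norm_le_one z) h⟩

theorem norm_sub_residueRep_lt_one_iff (z : 𝒪[K]) (i : 𝓀[K]) :
    ‖(z : K) - residueRep K i‖ < 1 ↔ IsLocalRing.residue 𝒪[K] z = i := by
  have h := (IsLocalRing.residue_surjective (R := 𝒪[K]) i).choose_spec
  have h2 := norm_lt_one_iff_residue_eq_zero
    (z - (IsLocalRing.residue_surjective (R := 𝒪[K]) i).choose)
  rw [map_sub, sub_eq_zero] at h2
  rw [h] at h2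
  exact h2

theorem existsUnique_residueRep {π : K} (hπ : IsUniformiser π) {z : K} (hz : ‖z‖ ≤ 1) :
    ∃! i : 𝓀[K], ‖z - residueRep K i‖ ≤ ‖π‖ := by
  have key (i : 𝓀[K]) : ‖z - residueRep K i‖ ≤ ‖π‖ ↔
      IsLocalRing.residue 𝒪[K] ⟨z, Valued.integer.mem_iff.2 hz⟩ = i := by
    rw [← norm_sub_residueRep_lt_one_iff]
    exact ⟨fun h => h.trans_lt hπ.lt_one, fun h => hπ.norm_le _ h⟩
  simp only [key]
  exact ⟨_, rfl, fun j hj => hj.symm⟩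

/-- By compactness finitely many open balls of radius one cover `O_K`, and each lies in a single
residue class. -/
theorem finite_residueField [ProperSpace K] : Finite 𝓀[K] := by
  obtain ⟨s, hs, hsf, hcov⟩ := (isCompact_closedBall (0 : K) 1).finite_cover_balls one_pos
  have hsub (z : K) (hz : z ∈ s) : ‖z‖ ≤ 1 := by simpa using hs hz
  have : (range (IsLocalRing.residue 𝒪[K])) ⊆
      (fun z : K => if h : ‖z‖ ≤ 1 then IsLocalRing.residue 𝒪[K] ⟨z, Valued.integer.mem_iff.2 h⟩
        else 0) '' s := by
    rintro _ ⟨z, rfl⟩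
    have hz : (z : K) ∈ closedBall (0 : K) 1 := by simpa using Valued.integer.norm_le_one z
    obtain ⟨y, hy, hzy⟩ := mem_iUnion₂.1 (hcov hz)
    refine ⟨y, hy, ?_⟩
    simp only [hsub y hy, dif_pos]
    rw [← sub_eq_zero, ← map_sub, ← norm_lt_one_iff_residue_eq_zero]
    rw [mem_ball, dist_eq_norm, norm_sub_rev] at hzy
    exact hzy
  have hfin := (hsf.image _).subset this
  rw [(IsLocalRing.residue_surjective (R := 𝒪[K])).range_eq] at hfin
  exact Set.finite_univ_iff.1 hfin

theorem two_le_residueCard [ProperSpace K] : 2 ≤ residueCard K := by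
  have := finite_residueField (K := K)
  exact Finite.one_lt_card_iff_nontrivial.2
    (inferInstanceAs (Nontrivial (IsLocalRing.ResidueField 𝒪[K])))

theorem residueCard_pos [ProperSpace K] : (0 : ℝ) < residueCard K := by
  have := two_le_residueCard (K := K)
  exact_mod_cast (by omega : 0 < residueCard K)

/-- The source of all congruences below. The bound `2 ≤ q` makes the natural subtraction `q - 1` a
true one. -/
theorem congrMod_residueCard [ProperSpace K] :
    CongrMod (residueCard K - 1) (residueCard K) 1 := by
  have h := CongrMod.natCast (residueCard K - 1) (residueCard K)
  have h2 := two_le_residueCard (K := K)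
  have : ((residueCard K : ℕ) : ZMod (residueCard K - 1)) = 1 := by
    obtain ⟨m, hm⟩ : ∃ m, residueCard K = m + 1 := ⟨residueCard K - 1, by omega⟩
    rw [hm]
    simp
  rwa [this] at h

/-- A ball is the union of the next smaller balls around the representatives of the residue
classes. -/
theorem closedBall_eq_iUnion {π : K} (hπ : IsUniformiser π) (a : K) (k : ℤ) :
    closedBall a (‖π‖ ^ k) =
      ⋃ i : 𝓀[K], closedBall (a + π ^ k * residueRep K i) (‖π‖ ^ (k + 1)) := by
  have hk := hπ.zpow_pos k
  have hne : π ^ k ≠ 0 := zpow_ne_zero _ hπ.ne_zero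
  ext x
  rw [mem_iUnion]
  constructor
  · intro hx
    rw [mem_closedBall, dist_eq_norm] at hx
    have hz : ‖(x - a) / π ^ k‖ ≤ 1 := by rwa [norm_div, norm_zpow, div_le_one hk]
    obtain ⟨i, hi, -⟩ := existsUnique_residueRep hπ hz
    refine ⟨i, ?_⟩
    rw [mem_closedBall, dist_eq_norm]
    have : x - (a + π ^ k * residueRep K i) = π ^ k * ((x - a) / π ^ k - residueRep K i) := by
      field_simp
      ring
    rw [this, norm_mul, norm_zpow, zpow_add_one₀ hπ.pos.ne']
    exact mul_le_mul_of_nonneg_left hi hk.le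
  · rintro ⟨i, hi⟩
    have h1 : x ∈ closedBall (a + π ^ k * residueRep K i) (‖π‖ ^ k) :=
      closedBall_subset_closedBall (hπ.zpow_le_zpow.2 (by omega)) hi
    have h2 : a + π ^ k * residueRep K i ∈ closedBall a (‖π‖ ^ k) := by
      rw [mem_closedBall, dist_eq_norm, add_sub_cancel_left, norm_mul, norm_zpow]
      exact mul_le_of_le_one_right hk.le (norm_residueRep_le i)
    rwa [IsUltrametricDist.closedBall_eq_of_mem h2]

theorem pairwise_disjoint_closedBall {π : K} (hπ : IsUniformiser π) (a : K) (k : ℤ) :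
    Pairwise (Function.onFun Disjoint fun i : 𝓀[K] =>
      closedBall (a + π ^ k * residueRep K i) (‖π‖ ^ (k + 1))) := by
  have hk := hπ.zpow_pos k
  have hne : π ^ k ≠ 0 := zpow_ne_zero _ hπ.ne_zero
  intro i j hij
  refine Set.disjoint_left.2 fun x hi hj => hij ?_
  have key (i : 𝓀[K]) (hi : x ∈ closedBall (a + π ^ k * residueRep K i) (‖π‖ ^ (k + 1))) :
      ‖(x - a) / π ^ k - residueRep K i‖ ≤ ‖π‖ := by
    rw [mem_closedBall, dist_eq_norm] at hi
    have : x - (a + π ^ k * residueRep K i) = π ^ k * ((x - a) / π ^ k - residueRep K i) := by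
      field_simp
      ring
    rw [this, norm_mul, norm_zpow, zpow_add_one₀ hπ.pos.ne'] at hi
    exact le_of_mul_le_mul_left hi hk
  have hx : x ∈ closedBall a (‖π‖ ^ k) := by
    rw [closedBall_eq_iUnion hπ]
    exact mem_iUnion.2 ⟨i, hi⟩
  rw [mem_closedBall, dist_eq_norm] at hx
  have hz : ‖(x - a) / π ^ k‖ ≤ 1 := by rwa [norm_div, norm_zpow, div_le_one hk]
  exact (existsUnique_residueRep hπ hz).unique (key i hi) (key j hj)

end Residues

/-! ### Haar measure of balls, and integrals over balls -/

section Haar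

variable {K : Type*} [NontriviallyNormedField K] [ProperSpace K] [MeasurableSpace K]
  [BorelSpace K]

instance : (haarK K).IsAddHaarMeasure := by
  unfold haarK
  infer_instance

theorem haarK_closedBall_one : haarK K (closedBall 0 1) = 1 :=
  Measure.addHaarMeasure_self

theorem haarK_closedBall_center (a : K) (r : ℝ) :
    haarK K (closedBall a r) = haarK K (closedBall 0 r) := by
  have := measure_preimage_add (haarK K) (-a) (closedBall 0 r)
  rw [← this]
  congr 1
  ext x
  simp [dist_eq_norm, sub_eq_add_neg, add_comm]

variable [IsUltrametricDist K] {π : K}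

theorem haarK_closedBall_succ (hπ : IsUniformiser π) (k : ℤ) :
    haarK K (closedBall 0 (‖π‖ ^ k)) =
      residueCard K * haarK K (closedBall 0 (‖π‖ ^ (k + 1))) := by
  have := finite_residueField (K := K)
  have := Fintype.ofFinite 𝓀[K]
  rw [closedBall_eq_iUnion hπ, measure_iUnion (pairwise_disjoint_closedBall hπ 0 k)
    fun _ => measurableSet_closedBall]
  simp only [haarK_closedBall_center (_ + _), tsum_fintype, Finset.sum_const, Finset.card_univ,
    nsmul_eq_mul, residueCard, Nat.card_eq_fintype_card]

theorem haarK_closedBall (hπ : IsUniformiser π) (a : K) (k : ℤ) :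
    haarK K (closedBall a (‖π‖ ^ k)) = ENNReal.ofReal ((residueCard K : ℝ) ^ (-k)) := by
  have hq := residueCard_pos (K := K)
  -- As an equivalence, the subdivision formula drives the induction in both directions from the
  -- unit ball, where the measure is normalised.
  have step (k : ℤ) (c : ℝ) :
      haarK K (closedBall 0 (‖π‖ ^ k)) = ENNReal.ofReal (residueCard K * c) ↔
        haarK K (closedBall 0 (‖π‖ ^ (k + 1))) = ENNReal.ofReal c := by
    rw [haarK_closedBall_succ hπ, ENNReal.ofReal_mul hq.le, ENNReal.ofReal_natCast]
    exact ENNReal.mul_right_inj (by exact_mod_cast hq.ne') (by simp)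
  rw [haarK_closedBall_center]
  induction k using Int.induction_on with
  | zero => simpa using haarK_closedBall_one (K := K)
  | succ k ih =>
    rw [← step, ih]
    congr 1
    rw [← zpow_one_add₀ hq.ne']
    congr 1
    ring
  | pred k ih =>
    have := (step (-k - 1) ((residueCard K : ℝ) ^ (-(-k : ℤ)))).2 (by simpa using ih)
    rw [this, ← zpow_one_add₀ hq.ne']
    congr 2
    ring

/-- The set `a • O_K` is the ball of radius `‖a‖` around zero. -/
theorem normAbs_eq (hπ : IsUniformiser π) {a : K} {k : ℤ} (h : ‖a‖ = ‖π‖ ^ k) :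
    normAbs a = ENNReal.ofReal ((residueCard K : ℝ) ^ (-k)) := by
  rw [normAbs, ← haarK_closedBall hπ 0 k, ← h]
  congr 1
  have ha : a ≠ 0 := norm_pos_iff.1 (h ▸ hπ.zpow_pos k)
  ext x
  simp [Set.mem_smul_set_iff_inv_smul_mem₀ ha, inv_mul_le_iff₀ (norm_pos_iff.2 ha)]

theorem normAbs_congr (hπ : IsUniformiser π) {a b : K} (ha : a ≠ 0) (h : ‖a‖ = ‖b‖) :
    normAbs a = normAbs b := by
  obtain ⟨k, hk⟩ := hπ.norm_eq_zpow ha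
  rw [normAbs_eq hπ hk, normAbs_eq hπ (h ▸ hk)]

theorem normAbs_mul (hπ : IsUniformiser π) {a b : K} (ha : a ≠ 0) (hb : b ≠ 0) :
    normAbs (a * b) = normAbs a * normAbs b := by
  obtain ⟨k, hk⟩ := hπ.norm_eq_zpow ha
  obtain ⟨l, hl⟩ := hπ.norm_eq_zpow hb
  have hq := residueCard_pos (K := K)
  rw [normAbs_eq hπ hk, normAbs_eq hπ hl, normAbs_eq hπ (k := k + l), ← ENNReal.ofReal_mul
    (zpow_pos hq _).le, ← zpow_add₀ hq.ne']
  · congr 2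
    ring
  · rw [norm_mul, hk, hl, zpow_add₀ hπ.pos.ne']

/-- The value in `ℝ≥0∞` is a positive fraction that is congruent to one modulo `q - 1`. -/
def IsUnitVolume (K : Type*) [NontriviallyNormedField K] [IsUltrametricDist K] (v : ℝ≥0∞) :
    Prop :=
  ∃ x : ℝ, 0 < x ∧ v = ENNReal.ofReal x ∧ CongrMod (residueCard K - 1) x 1

theorem isUnitVolume_lintegral_of_const (hπ : IsUniformiser π) (f : K → K) (a : K) (k : ℤ)
    (h0 : f a ≠ 0) (h : ∀ x ∈ closedBall a (‖π‖ ^ k), ‖f x‖ = ‖f a‖) :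
    IsUnitVolume K (∫⁻ z in closedBall a (‖π‖ ^ k), normAbs (f z) ∂(haarK K)) := by
  have hq := residueCard_pos (K := K)
  obtain ⟨l, hl⟩ := hπ.norm_eq_zpow h0
  refine ⟨(residueCard K : ℝ) ^ (-l) * (residueCard K : ℝ) ^ (-k), by positivity, ?_, ?_⟩
  · rw [setLIntegral_congr_fun (g := fun _ => ENNReal.ofReal ((residueCard K : ℝ) ^ (-l)))
      measurableSet_closedBall fun x hx => normAbs_eq hπ ((h x hx).trans hl),
      setLIntegral_const, haarK_closedBall hπ, ENNReal.ofReal_mul (zpow_pos hq _).le]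
  · simpa using (congrMod_residueCard.zpow hq (-l)).mul (congrMod_residueCard.zpow hq (-k))

/-- Induction on the depth `n` at which `‖f‖` becomes constant. A ball has `q` children of depth one
less; each contributes a value congruent to 1, and `q ≡ 1`. -/
theorem isUnitVolume_lintegral_of_const_on_small (hπ : IsUniformiser π) (f : K → K) (n : ℕ) :
    ∀ (a : K) (k : ℤ), (∀ x ∈ closedBall a (‖π‖ ^ k), f x ≠ 0) →
      (∀ x ∈ closedBall a (‖π‖ ^ k), ∀ y ∈ closedBall x (‖π‖ ^ (k + n)), ‖f y‖ = ‖f x‖) →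
      IsUnitVolume K (∫⁻ z in closedBall a (‖π‖ ^ k), normAbs (f z) ∂(haarK K)) := by
  induction n with
  | zero =>
    intro a k h0 h
    have ha := mem_closedBall_self (x := a) (hπ.zpow_pos k).le
    exact isUnitVolume_lintegral_of_const hπ f a k (h0 a ha) fun y hy =>
      h a ha y (by simpa using hy)
  | succ n ih =>
    intro a k h0 h
    have := finite_residueField (K := K)
    have := Fintype.ofFinite 𝓀[K]
    have hsub (i : 𝓀[K]) : closedBall (a + π ^ k * residueRep K i) (‖π‖ ^ (k + 1)) ⊆
        closedBall a (‖π‖ ^ k) := by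
      rw [closedBall_eq_iUnion hπ a k]
      exact subset_iUnion (fun i => closedBall (a + π ^ k * residueRep K i) (‖π‖ ^ (k + 1))) i
    have hi (i : 𝓀[K]) := ih (a + π ^ k * residueRep K i) (k + 1)
      (fun x hx => h0 x (hsub i hx))
      (fun x hx y hy => h x (hsub i hx) y (by
        convert hy using 3
        push_cast
        ring))
    choose v hv0 hv hvc using hi
    refine ⟨∑ i, v i, Finset.sum_pos (fun i _ => hv0 i) ⟨0, Finset.mem_univ _⟩, ?_, ?_⟩
    · rw [closedBall_eq_iUnion hπ, lintegral_iUnion (fun _ => measurableSet_closedBall)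
        (pairwise_disjoint_closedBall hπ a k), tsum_fintype,
        ENNReal.ofReal_sum_of_nonneg fun i _ => (hv0 i).le]
      exact Finset.sum_congr rfl fun i _ => hv i
    · have h1 := CongrMod.sum Finset.univ fun i _ => hvc i
      have h2 : (∑ _i : 𝓀[K], (1 : ZMod (residueCard K - 1))) = 1 := by
        rw [Finset.sum_const, nsmul_one, Finset.card_univ, ← Nat.card_eq_fintype_card]
        exact (CongrMod.natCast _ (residueCard K)).unique congrMod_residueCard
      rwa [h2] at h1

/-- The integral of the absolute value of a continuous function without zeros over a ball is
congruent to one modulo `q - 1`. -/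
theorem isUnitVolume_lintegral (hπ : IsUniformiser π) (f : K → K) (a : K) (k : ℤ)
    (hf : ContinuousOn f (closedBall a (‖π‖ ^ k))) (h0 : ∀ x ∈ closedBall a (‖π‖ ^ k), f x ≠ 0) :
    IsUnitVolume K (∫⁻ z in closedBall a (‖π‖ ^ k), normAbs (f z) ∂(haarK K)) := by
  have hD := isCompact_closedBall a (‖π‖ ^ k)
  have hloc : ∀ x ∈ closedBall a (‖π‖ ^ k), ∃ U, IsOpen U ∧ x ∈ U ∧ ∀ y ∈ U, ‖f y‖ = ‖f x‖ := by
    intro x hx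
    have hn := hf.continuousAt ((hπ.isOpen_closedBall a k).mem_nhds hx)
    obtain ⟨U, hU, hUo, hxU⟩ := _root_.eventually_nhds_iff.1 (eventually_norm_eq hn (h0 x hx))
    exact ⟨U, hUo, hxU, hU⟩
  choose! U hUo hxU hU using hloc
  -- Compactness makes the radius of constancy uniform; `n` is then chosen so that `‖π‖ ^ (k + n) <
  -- δ`.
  obtain ⟨δ, hδ, hleb⟩ := lebesgue_number_lemma_of_metric (ι := closedBall a (‖π‖ ^ k)) hD
    (fun x => hUo x x.2) fun x hx => mem_iUnion.2 ⟨⟨x, hx⟩, hxU x hx⟩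
  obtain ⟨n, hn⟩ := exists_pow_lt_of_lt_one (div_pos hδ (hπ.zpow_pos k)) hπ.lt_one
  rw [lt_div_iff₀ (hπ.zpow_pos k)] at hn
  refine isUnitVolume_lintegral_of_const_on_small hπ f n a k h0 fun x hx y hy => ?_
  obtain ⟨i, hi⟩ := hleb x hx
  rw [hU i i.2 x (hi (mem_ball_self hδ))]
  refine hU i i.2 y (hi (lt_of_le_of_lt (mem_closedBall.1 hy) ?_))
  rwa [zpow_add₀ hπ.pos.ne', zpow_natCast, mul_comm]

end Haar

/-! ### Change of variables -/

section Measurability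

variable {X Y : Type*} [TopologicalSpace X] [TopologicalSpace Y] [MeasurableSpace X]
  [OpensMeasurableSpace X] [MeasurableSpace Y] [BorelSpace Y]

theorem OpenPartialHomeomorph.measurableSet_source_inter_preimage (e : OpenPartialHomeomorph X Y)
    {s : Set Y} (hs : MeasurableSet s) : MeasurableSet (e.source ∩ e ⁻¹' s) := by
  have h : Measurable (e.source.domRestrict e) :=
    (continuousOn_iff_continuous_domRestrict.1 e.continuousOn).measurable
  have h2 := e.open_source.measurableSet.subtype_image (h hs)
  convert h2 using 1
  ext x
  simp only [mem_inter_iff, mem_preimage, mem_image, Subtype.exists,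
    exists_and_right, exists_eq_right]
  exact ⟨fun h => ⟨h.1, h.2⟩, fun ⟨h, h'⟩ => ⟨h, h'⟩⟩

/-- Nothing is known of `e` off its source, so it is replaced there by a constant. -/
theorem OpenPartialHomeomorph.aemeasurable_restrict (e : OpenPartialHomeomorph X Y)
    {s : Set X} (hs : MeasurableSet s) (hse : s ⊆ e.source) (μ : Measure X) :
    AEMeasurable e (μ.restrict s) := by
  rcases isEmpty_or_nonempty Y with hY | ⟨⟨y₀⟩⟩
  · have : IsEmpty X := ⟨fun x => hY.elim (e x)⟩
    exact (measurable_of_empty e).aemeasurable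
  classical
  refine ⟨s.piecewise e fun _ => y₀, ?_, ?_⟩
  · refine fun t ht => ?_
    rw [piecewise_preimage, Set.ite]
    refine MeasurableSet.union ?_ ((measurable_const ht).diff hs)
    convert (e.measurableSet_source_inter_preimage ht).inter hs using 1
    ext x
    exact ⟨fun h => ⟨⟨hse h.2, h.1⟩, h.2⟩, fun h => ⟨h.1.2, h.2⟩⟩
  · filter_upwards [ae_restrict_mem hs] with x hx
    exact (piecewise_eq_of_mem _ _ _ hx).symm

end Measurability

theorem OpenPartialHomeomorph.measurableSet_image {X Y : Type*} [TopologicalSpace X]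
    [TopologicalSpace Y] [MeasurableSpace X] [BorelSpace X] [MeasurableSpace Y]
    [OpensMeasurableSpace Y] (e : OpenPartialHomeomorph X Y)
    {s : Set X} (hs : MeasurableSet s) (hse : s ⊆ e.source) : MeasurableSet (e '' s) := by
  rw [e.image_eq_target_inter_inv_preimage hse]
  exact e.symm.measurableSet_source_inter_preimage hs

section ChangeOfVariables

variable {K : Type*} [NontriviallyNormedField K] {π : K}

theorem IsUniformiser.exists_closedBall_subset (hπ : IsUniformiser π) {a : K} {N : Set K}
    (hN : N ∈ 𝓝 a) : ∃ k : ℤ, ∀ l, k ≤ l → closedBall a (‖π‖ ^ l) ⊆ N := by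
  obtain ⟨r, hr, hrN⟩ := Metric.nhds_basis_closedBall.mem_iff.1 hN
  obtain ⟨k, hk, -⟩ := hπ.exists_zpow_bracket hr
  exact ⟨k, fun l hl =>
    (closedBall_subset_closedBall ((hπ.zpow_le_zpow.2 hl).trans hk)).trans hrN⟩

variable [IsUltrametricDist K]

/-- The error term is at most half of the linear term, and the ultrametric inequality turns this
into an exact equality of norms. -/
theorem HasStrictDerivAt.eventually_norm_sub_eq {f : K → K} {c z : K}
    (hf : HasStrictDerivAt f c z) (hc : c ≠ 0) :
    ∀ᶠ p : K × K in 𝓝 (z, z), ‖f p.1 - f p.2‖ = ‖c‖ * ‖p.1 - p.2‖ := by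
  have hc' := norm_pos_iff.2 hc
  have h := hf.isLittleO.bound (half_pos hc')
  filter_upwards [h] with p hp
  rcases eq_or_ne p.1 p.2 with he | hne
  · simp [he]
  · have h1 : ‖(p.1 - p.2) * c‖ = ‖c‖ * ‖p.1 - p.2‖ := by rw [norm_mul, mul_comm]
    have h2 : 0 < ‖p.1 - p.2‖ := norm_pos_iff.2 (sub_ne_zero.2 hne)
    rw [← h1]
    refine TateCurve.norm_eq_of_near ?_
    rw [h1]
    have h3 : ‖f p.1 - f p.2 - (p.1 - p.2) * c‖ ≤ ‖c‖ / 2 * ‖p.1 - p.2‖ := by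
      simpa using hp
    have := mul_pos hc' h2
    linarith

theorem HasStrictDerivAt.exists_closedBall_norm_sub_eq (hπ : IsUniformiser π) {f : K → K}
    {c z : K} (hf : HasStrictDerivAt f c z) (hc : c ≠ 0) :
    ∃ k : ℤ, ∀ x ∈ closedBall z (‖π‖ ^ k), ∀ y ∈ closedBall z (‖π‖ ^ k),
      ‖f x - f y‖ = ‖c‖ * ‖x - y‖ := by
  have h := hf.eventually_norm_sub_eq hc
  rw [nhds_prod_eq] at h
  obtain ⟨N, hN, h⟩ := Filter.eventually_prod_self_iff'.1 h
  obtain ⟨k, hk⟩ := hπ.exists_closedBall_subset hN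
  exact ⟨k, fun x hx y hy => h x (hk k le_rfl hx) y (hk k le_rfl hy)⟩

/-- Near a point where its derivative does not vanish, an invertible map is a similarity between
balls. -/
theorem OpenPartialHomeomorph.exists_similarity [CompleteSpace K] (hπ : IsUniformiser π)
    (T : OpenPartialHomeomorph K K)
    {c z : K} (hz : z ∈ T.source) (hT : HasStrictDerivAt T c z) (hc : c ≠ 0) {l : ℤ}
    (hl : ‖c‖ = ‖π‖ ^ l) {N : Set K} (hN : N ∈ 𝓝 z) :
    ∃ k : ℤ, closedBall z (‖π‖ ^ k) ⊆ N ∩ T.source ∧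
      (∀ x ∈ closedBall z (‖π‖ ^ k), ∀ y ∈ closedBall z (‖π‖ ^ k),
        ‖T x - T y‖ = ‖c‖ * ‖x - y‖) ∧
      T '' closedBall z (‖π‖ ^ k) = closedBall (T z) (‖π‖ ^ (l + k)) := by
  have hTz := T.map_source hz
  have hT' : HasStrictDerivAt T.symm c⁻¹ (T z) :=
    T.hasStrictDerivAt_symm hTz hc (by rwa [T.left_inv hz])
  obtain ⟨k₁, h₁⟩ := hT.exists_closedBall_norm_sub_eq hπ hc
  obtain ⟨k₂, h₂⟩ := hT'.exists_closedBall_norm_sub_eq hπ (inv_ne_zero hc)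
  obtain ⟨k₃, h₃⟩ := hπ.exists_closedBall_subset
    (Filter.inter_mem hN (T.open_source.mem_nhds hz))
  obtain ⟨k₄, h₄⟩ := hπ.exists_closedBall_subset (T.open_target.mem_nhds hTz)
  -- The ball must be small enough for `T` to be a similarity and to lie in `N` and the source; its
  -- expected image must be small enough for `T.symm` and lie in the target.
  obtain ⟨k, hk₁, hk₂, hk₃, hk₄⟩ : ∃ k : ℤ, k₁ ≤ k ∧ k₂ ≤ l + k ∧ k₃ ≤ k ∧ k₄ ≤ l + k :=
    ⟨max (max k₁ (k₂ - l)) (max k₃ (k₄ - l)), by omega, by omega, by omega, by omega⟩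
  have hsim : ∀ x ∈ closedBall z (‖π‖ ^ k), ∀ y ∈ closedBall z (‖π‖ ^ k),
      ‖T x - T y‖ = ‖c‖ * ‖x - y‖ := fun x hx y hy =>
    h₁ x (hπ.closedBall_subset_iff.2 hk₁ hx) y (hπ.closedBall_subset_iff.2 hk₁ hy)
  have hzmem := mem_closedBall_self (x := z) (hπ.zpow_pos k).le
  have hTzmem := mem_closedBall_self (x := T z) (hπ.zpow_pos k₂).le
  refine ⟨k, h₃ k hk₃, hsim, Subset.antisymm ?_ fun u hu => ?_⟩
  · rintro _ ⟨x, hx, rfl⟩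
    rw [mem_closedBall, dist_eq_norm, hsim x hx z hzmem, hl, zpow_add₀ hπ.pos.ne']
    rw [mem_closedBall, dist_eq_norm] at hx
    exact mul_le_mul_of_nonneg_left hx (hπ.zpow_pos l).le
  · have hut : u ∈ T.target := h₄ _ hk₄ hu
    refine ⟨T.symm u, ?_, T.right_inv hut⟩
    have h := h₂ u (hπ.closedBall_subset_iff.2 hk₂ hu) (T z) hTzmem
    rw [T.left_inv hz] at h
    rw [mem_closedBall, dist_eq_norm, h, norm_inv, inv_mul_le_iff₀ (norm_pos_iff.2 hc), hl,
      ← zpow_add₀ hπ.pos.ne']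
    rwa [mem_closedBall, dist_eq_norm] at hu

theorem IsUniformiser.isTopologicalBasis (hπ : IsUniformiser π) :
    TopologicalSpace.IsTopologicalBasis {s : Set K | ∃ a, ∃ k : ℤ, s = closedBall a (‖π‖ ^ k)} := by
  refine TopologicalSpace.isTopologicalBasis_of_isOpen_of_nhds ?_ fun a u ha hu => ?_
  · rintro _ ⟨a, k, rfl⟩
    exact hπ.isOpen_closedBall a k
  · obtain ⟨k, hk⟩ := hπ.exists_closedBall_subset (hu.mem_nhds ha)
    exact ⟨_, ⟨a, k, rfl⟩, mem_closedBall_self (hπ.zpow_pos k).le, hk k le_rfl⟩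

/-- Two balls are nested or disjoint. -/
theorem IsUltrametricDist.isPiSystem_closedBall (π : K) :
    IsPiSystem {s : Set K | ∃ a, ∃ k : ℤ, s = closedBall a (‖π‖ ^ k)} := by
  rintro _ ⟨a, k, rfl⟩ _ ⟨b, l, rfl⟩ hne
  rcases IsUltrametricDist.closedBall_subset_trichotomy (x := a) (y := b) (r := ‖π‖ ^ k)
    (s := ‖π‖ ^ l) with h | h | h
  · exact ⟨a, k, inter_eq_left.2 h⟩
  · exact ⟨b, l, inter_eq_right.2 h⟩
  · exact absurd (disjoint_iff_inter_eq_empty.1 h) hne.ne_empty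

variable [ProperSpace K] [MeasurableSpace K] [BorelSpace K]

/-- Finite measures on `K` that agree on balls are equal. -/
theorem IsUniformiser.measure_ext (hπ : IsUniformiser π) {μ ν : Measure K} [IsFiniteMeasure μ]
    (h : ∀ a, ∀ k : ℤ, μ (closedBall a (‖π‖ ^ k)) = ν (closedBall a (‖π‖ ^ k)))
    (huniv : μ univ = ν univ) : μ = ν := by
  refine ext_of_generate_finite _ ?_ (IsUltrametricDist.isPiSystem_closedBall π) ?_ huniv
  · rw [BorelSpace.measurable_eq (α := K)]
    exact hπ.isTopologicalBasis.borel_eq_generateFrom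
  · rintro _ ⟨a, k, rfl⟩
    exact h a k

/-- A similarity between balls scales the Haar measure by the absolute value of its factor. -/
theorem OpenPartialHomeomorph.haarK_image (hπ : IsUniformiser π) (T : OpenPartialHomeomorph K K)
    {c z : K} {k l : ℤ} (hl : ‖c‖ = ‖π‖ ^ l) (hV : closedBall z (‖π‖ ^ k) ⊆ T.source)
    (hsim : ∀ x ∈ closedBall z (‖π‖ ^ k), ∀ y ∈ closedBall z (‖π‖ ^ k),
        ‖T x - T y‖ = ‖c‖ * ‖x - y‖)
    (himg : T '' closedBall z (‖π‖ ^ k) = closedBall (T z) (‖π‖ ^ (l + k)))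
    {E : Set K} (hE : MeasurableSet E) (hEV : E ⊆ closedBall z (‖π‖ ^ k)) :
    haarK K (T '' E) = normAbs c * haarK K E := by
  set V := closedBall z (‖π‖ ^ k) with hVdef
  have hTV : T '' V ⊆ T.target := by
    rintro _ ⟨x, hx, rfl⟩
    exact T.map_source (hV hx)
  have hTVm : MeasurableSet (T '' V) := himg ▸ measurableSet_closedBall
  have hq := residueCard_pos (K := K)
  -- Pulling the Haar measure of `T '' V` back to `V` gives a finite measure, which need only be
  -- compared with `normAbs c • haarK K` on balls.
  set ν := ((haarK K).restrict (T '' V)).map T.symm with hν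
  have hae := T.symm.aemeasurable_restrict hTVm hTV (haarK K)
  have hpre (E : Set K) : T.symm ⁻¹' E ∩ T '' V = T '' (E ∩ V) := by
    ext u
    constructor
    · rintro ⟨hu, x, hx, rfl⟩
      rw [mem_preimage, T.left_inv (hV hx)] at hu
      exact ⟨x, ⟨hu, hx⟩, rfl⟩
    · rintro ⟨x, ⟨hxE, hx⟩, rfl⟩
      exact ⟨by rwa [mem_preimage, T.left_inv (hV hx)], x, hx, rfl⟩
  have happ {E : Set K} (hE : MeasurableSet E) : ν E = haarK K (T '' (E ∩ V)) := by
    rw [hν, Measure.map_apply_of_aemeasurable hae hE, Measure.restrict_apply' hTVm, hpre]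
  have hball (x : K) (m : ℤ) (hx : x ∈ V) (hm : k ≤ m) :
      haarK K (T '' closedBall x (‖π‖ ^ m)) = normAbs c * haarK K (closedBall x (‖π‖ ^ m)) := by
    have hsub : closedBall x (‖π‖ ^ m) ⊆ V := by
      rw [hVdef, IsUltrametricDist.closedBall_eq_of_mem hx]
      exact hπ.closedBall_subset_iff.2 hm
    have : T '' closedBall x (‖π‖ ^ m) = closedBall (T x) (‖π‖ ^ (l + m)) := by
      refine Subset.antisymm ?_ fun u hu => ?_
      · rintro _ ⟨y, hy, rfl⟩
        rw [mem_closedBall, dist_eq_norm, hsim y (hsub hy) x hx, hl, zpow_add₀ hπ.pos.ne']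
        rw [mem_closedBall, dist_eq_norm] at hy
        exact mul_le_mul_of_nonneg_left hy (hπ.zpow_pos l).le
      · have hu' : u ∈ T '' V := by
          have hTx : T x ∈ closedBall (T z) (‖π‖ ^ (l + k)) := himg ▸ mem_image_of_mem T hx
          rw [himg, IsUltrametricDist.closedBall_eq_of_mem hTx]
          exact hπ.closedBall_subset_iff.2 (by omega) hu
        obtain ⟨y, hy, rfl⟩ := hu'
        refine ⟨y, ?_, rfl⟩
        rw [mem_closedBall, dist_eq_norm, hsim y hy x hx, hl, zpow_add₀ hπ.pos.ne'] at hu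
        rw [mem_closedBall, dist_eq_norm]
        exact le_of_mul_le_mul_left hu (hπ.zpow_pos l)
    rw [this, haarK_closedBall hπ, haarK_closedBall hπ, normAbs_eq hπ hl,
      ← ENNReal.ofReal_mul (zpow_pos hq _).le, ← zpow_add₀ hq.ne']
    congr 2
    ring
  have hzV : z ∈ V := mem_closedBall_self (hπ.zpow_pos k).le
  have hVeq := hball z k hzV le_rfl
  have hfin : IsFiniteMeasure ν := by
    refine ⟨?_⟩
    rw [happ MeasurableSet.univ, univ_inter, himg, haarK_closedBall hπ]
    exact ENNReal.ofReal_lt_top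
  have heq : ν = normAbs c • (haarK K).restrict V := by
    refine hπ.measure_ext (fun a m => ?_) ?_
    · rw [happ measurableSet_closedBall, Measure.smul_apply, smul_eq_mul,
        Measure.restrict_apply measurableSet_closedBall]
      rcases IsUltrametricDist.closedBall_subset_trichotomy (x := a) (y := z) (r := ‖π‖ ^ m)
        (s := ‖π‖ ^ k) with h | h | h
      · rw [inter_eq_left.2 h]
        have ha : a ∈ V := h (mem_closedBall_self (hπ.zpow_pos m).le)
        refine hball a m ha ?_
        rw [IsUltrametricDist.closedBall_eq_of_mem ha] at h
        exact hπ.closedBall_subset_iff.1 h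
      · rw [inter_eq_right.2 h]
        exact hVeq
      · rw [disjoint_iff_inter_eq_empty.1 h]
        simp
    · rw [happ MeasurableSet.univ, univ_inter, Measure.smul_apply, smul_eq_mul,
        Measure.restrict_apply MeasurableSet.univ, univ_inter]
      exact hVeq
  have h := congrArg (fun μ => μ E) heq
  simp only [Measure.smul_apply, smul_eq_mul] at h
  rwa [happ hE, Measure.restrict_apply hE, inter_eq_left.2 hEV] at h

/-- Change of variables near a point. -/
theorem OpenPartialHomeomorph.exists_lintegral_image_eq (hπ : IsUniformiser π)
    (T : OpenPartialHomeomorph K K) {f g : K → K} {c z : K} (hz : z ∈ T.source)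
    (hT : HasStrictDerivAt T c z) (hf : ContinuousAt f z) (hg : ContinuousAt g (T z))
    (hf0 : f z ≠ 0) (hfg : f z = g (T z) * c) :
    ∃ V, IsOpen V ∧ z ∈ V ∧ ∀ E, MeasurableSet E → E ⊆ V →
      ∫⁻ x in T '' E, normAbs (g x) ∂(haarK K) = ∫⁻ x in E, normAbs (f x) ∂(haarK K) := by
  have hc : c ≠ 0 := right_ne_zero_of_mul (hfg ▸ hf0)
  have hg0 : g (T z) ≠ 0 := left_ne_zero_of_mul (hfg ▸ hf0)
  obtain ⟨l, hl⟩ := hπ.norm_eq_zpow hc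
  have h1 := eventually_norm_eq hf hf0
  have h2 := (T.continuousAt hz).eventually (eventually_norm_eq hg hg0)
  obtain ⟨k, hk, hsim, himg⟩ := T.exists_similarity hπ hz hT hc hl (h1.and h2)
  refine ⟨_, hπ.isOpen_closedBall z k, mem_closedBall_self (hπ.zpow_pos k).le,
    fun E hE hEV => ?_⟩
  have hES : E ⊆ T.source := hEV.trans (hk.trans inter_subset_right)
  -- On the chosen ball both integrands are constant, so only the scaling of Haar measure by
  -- `normAbs c` is left.
  rw [setLIntegral_congr_fun (g := fun _ => normAbs (g (T z))) (T.measurableSet_image hE hES) ?_,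
    setLIntegral_congr_fun (g := fun _ => normAbs (f z)) hE ?_, setLIntegral_const,
    setLIntegral_const, T.haarK_image hπ hl (hk.trans inter_subset_right) hsim himg hE hEV, hfg,
    normAbs_mul hπ hg0 hc, mul_assoc]
  · exact fun x hx => (normAbs_congr hπ hf0 (hk (hEV hx)).1.1.symm).symm
  · rintro _ ⟨x, hx, rfl⟩
    exact (normAbs_congr hπ hg0 (hk (hEV hx)).1.2.symm).symm

/-- Change of variables. -/
theorem OpenPartialHomeomorph.lintegral_image_eq (hπ : IsUniformiser π)
    (T : OpenPartialHomeomorph K K) {f g : K → K}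
    (hT : ∀ z ∈ T.source, HasStrictDerivAt T (deriv T z) z)
    (hf : ∀ z ∈ T.source, ContinuousAt f z) (hg : ∀ z ∈ T.target, ContinuousAt g z)
    (hf0 : ∀ z ∈ T.source, f z ≠ 0) (hfg : ∀ z ∈ T.source, f z = g (T z) * deriv T z)
    {E : Set K} (hE : MeasurableSet E) (hES : E ⊆ T.source) :
    ∫⁻ x in T '' E, normAbs (g x) ∂(haarK K) = ∫⁻ x in E, normAbs (f x) ∂(haarK K) := by
  have hloc (z : K) : ∃ V, IsOpen V ∧ z ∈ V ∧ (z ∈ T.source → ∀ E, MeasurableSet E → E ⊆ V →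
      ∫⁻ x in T '' E, normAbs (g x) ∂(haarK K) = ∫⁻ x in E, normAbs (f x) ∂(haarK K)) := by
    by_cases hz : z ∈ T.source
    · obtain ⟨V, hV, hzV, h⟩ := T.exists_lintegral_image_eq hπ hz (hT z hz) (hf z hz)
        (hg _ (T.map_source hz)) (hf0 z hz) (hfg z hz)
      exact ⟨V, hV, hzV, fun _ => h⟩
    -- A default value off the source, so that `V` is defined on all of `K`.
    · exact ⟨univ, isOpen_univ, mem_univ z, fun h => absurd h hz⟩
  choose V hV hzV h using hloc
  obtain ⟨t, htS, htc, ht⟩ := TopologicalSpace.countable_cover_nhdsWithin (s := T.source)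
    (f := fun z => V z) fun z _ => mem_nhdsWithin_of_mem_nhds ((hV z).mem_nhds (hzV z))
  have htm := T.open_target.measurableSet
  have hae := T.symm.aemeasurable_restrict htm subset_rfl
    ((haarK K).withDensity fun x => normAbs (g x))
  set μ := (((haarK K).withDensity fun x => normAbs (g x)).restrict T.target).map T.symm with hμ
  have happ {E : Set K} (hE : MeasurableSet E) (hES : E ⊆ T.source) :
      μ E = ∫⁻ x in T '' E, normAbs (g x) ∂(haarK K) := by
    rw [hμ, Measure.map_apply_of_aemeasurable hae hE, Measure.restrict_apply' htm, inter_comm,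
      ← T.image_eq_target_inter_inv_preimage hES,
      withDensity_apply _ (T.measurableSet_image hE hES)]
  -- Measures that agree on each of countably many small sets agree on their union.
  have key := (Measure.restrict_biUnion_congr (μ := μ)
    (ν := (haarK K).withDensity fun x => normAbs (f x)) (t := fun z => V z ∩ T.source) htc).2
    fun z hz => by
      ext E hE
      have hm := hE.inter ((hV z).inter T.open_source).measurableSet
      rw [Measure.restrict_apply hE, Measure.restrict_apply hE,
        happ hm fun x hx => hx.2.2, withDensity_apply _ hm]
      exact h z (htS hz) _ hm fun x hx => hx.2.1
  have hEt : E ⊆ ⋃ z ∈ t, V z ∩ T.source := fun x hx => by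
    obtain ⟨z, hz, hxz⟩ := mem_iUnion₂.1 (ht (hES hx))
    exact mem_iUnion₂.2 ⟨z, hz, hxz, hES hx⟩
  have := congrArg (fun μ => μ E) key
  simp only [Measure.restrict_apply hE, inter_eq_left.2 hEt] at this
  rwa [happ hE hES, withDensity_apply _ hE] at this

end ChangeOfVariables

/-! ### Independence of volumes from the chart -/

section Charts

variable {K : Type*} [NontriviallyNormedField K] {X : Type*} [TopologicalSpace X]
  [ChartedSpace K X]

theorem mem_contDiffGroupoid_iff (T : OpenPartialHomeomorph K K) :
    T ∈ contDiffGroupoid ω 𝓘(K, K) ↔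
      ContDiffOn K ω T T.source ∧ ContDiffOn K ω T.symm T.target := by
  rw [contDiffGroupoid, mem_groupoid_of_pregroupoid, contDiffPregroupoid]
  simp

/-- A change between analytic charts is strictly differentiable. -/
theorem hasStrictDerivAt_of_mem_analyticCharts [CompleteSpace K] {φ ψ : OpenPartialHomeomorph X K}
    (hφ : φ ∈ analyticCharts K X) (hψ : ψ ∈ analyticCharts K X) {z : K}
    (hz : z ∈ (φ.symm.trans ψ).source) :
    HasStrictDerivAt (φ.symm.trans ψ) (deriv (φ.symm.trans ψ) z) z :=
  AnalyticAt.hasStrictDerivAt <| ContDiffAt.analyticAt <|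
    ((mem_contDiffGroupoid_iff _).1 (IsManifold.compatible_of_mem_maximalAtlas hφ hψ)).1.contDiffAt
      ((φ.symm.trans ψ).open_source.mem_nhds hz)

variable [IsUltrametricDist K] [ProperSpace K] [MeasurableSpace K] [BorelSpace K]
  [MeasurableSpace X] [BorelSpace X]

/-- The volume of a set computed in a chart does not depend on the chart. -/
theorem AnalyticOneForm.lintegral_chart_eq {π : K} (hπ : IsUniformiser π)
    {η : AnalyticOneForm K X} (hη : η.NowhereVanishing) {φ ψ : OpenPartialHomeomorph X K}
    (hφ : φ ∈ analyticCharts K X) (hψ : ψ ∈ analyticCharts K X) {A : Set X}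
    (hA : MeasurableSet A) (hAφ : A ⊆ φ.source) (hAψ : A ⊆ ψ.source) :
    ∫⁻ z in ψ '' A, normAbs (η.coeff ψ z) ∂(haarK K) =
      ∫⁻ z in φ '' A, normAbs (η.coeff φ z) ∂(haarK K) := by
  have hmem {z : K} (hz : z ∈ (φ.symm.trans ψ).source) :
      z ∈ φ.target ∧ φ.symm z ∈ ψ.source := by
    rwa [OpenPartialHomeomorph.trans_source] at hz
  have hsrc : φ '' A ⊆ (φ.symm.trans ψ).source := by
    rintro _ ⟨x, hx, rfl⟩
    rw [OpenPartialHomeomorph.trans_source]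
    refine ⟨φ.map_source (hAφ hx), ?_⟩
    rw [mem_preimage, φ.left_inv (hAφ hx)]
    exact hAψ hx
  have himg : ψ '' A = (φ.symm.trans ψ) '' (φ '' A) := by
    rw [image_image]
    refine image_congr fun x hx => ?_
    simp [φ.left_inv (hAφ hx)]
  rw [himg]
  refine (φ.symm.trans ψ).lintegral_image_eq hπ
    (fun z hz => hasStrictDerivAt_of_mem_analyticCharts hφ hψ hz)
    (fun z hz => (η.analytic φ hφ z (hmem hz).1).continuousAt)
    (fun z hz => (η.analytic ψ hψ z ?_).continuousAt)
    (fun z hz => hη φ hφ z (hmem hz).1) (fun z hz => ?_)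
    (φ.measurableSet_image hA hAφ) hsrc
  · rw [OpenPartialHomeomorph.trans_target] at hz
    exact hz.1
  · have h := η.compatible φ hφ ψ hψ (φ.symm z) ⟨φ.map_target (hmem hz).1, (hmem hz).2⟩
    rwa [φ.right_inv (hmem hz).1] at h

end Charts

/-! ### The measure of a nowhere vanishing form -/

section Volume

variable {K : Type*} [NontriviallyNormedField K] [IsUltrametricDist K] [ProperSpace K]
  [MeasurableSpace K] [BorelSpace K] {X : Type*} [TopologicalSpace X] [ChartedSpace K X]
  [MeasurableSpace X] {π : K} {η : AnalyticOneForm K X}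

/-- The volume of a set that an analytic chart maps onto a ball is congruent to one. -/
theorem AnalyticOneForm.IsVolume.isUnitVolume (hπ : IsUniformiser π) (hη : η.NowhereVanishing)
    {μ : Measure X} (hμ : η.IsVolume μ) {φ : OpenPartialHomeomorph X K}
    (hφ : φ ∈ analyticCharts K X) {A : Set X} (hA : MeasurableSet A) (hAφ : A ⊆ φ.source) {a : K}
    {k : ℤ} (himg : φ '' A = closedBall a (‖π‖ ^ k)) : IsUnitVolume K (μ A) := by
  have hsub : closedBall a (‖π‖ ^ k) ⊆ φ.target := by
    rw [← himg, ← φ.image_source_eq_target]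
    exact image_mono hAφ
  rw [hμ φ hφ A hA hAφ, himg]
  exact isUnitVolume_lintegral hπ _ a k ((η.analytic φ hφ).continuousOn.mono hsub)
    fun x hx => hη φ hφ x (hsub hx)

variable [BorelSpace X]

/-- The measures `|f| dz` of the `r` disjoint charts are transported to `X` and added;
`lintegral_chart_eq` on each piece gives the formula in every other chart. Without existence,
`AnalyticOneForm.measure` would be its default value zero. -/
theorem AnalyticOneForm.exists_isVolume (hπ : IsUniformiser π) (hη : η.NowhereVanishing) {r : ℕ}
    (hr : IsDisjointUnionOfUnitBalls K X r) : ∃ μ : Measure X, η.IsVolume μ := by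
  obtain ⟨e, he, hdisj, hcov⟩ := hr
  let ν (j : Fin r) : Measure X :=
    (((haarK K).withDensity fun z => normAbs (η.coeff (e j) z)).restrict (e j).target).map
      (e j).symm
  have hν (j : Fin r) {A : Set X} (hA : MeasurableSet A) :
      ν j A = ∫⁻ z in e j '' ((e j).source ∩ A), normAbs (η.coeff (e j) z) ∂(haarK K) := by
    have htm := (e j).open_target.measurableSet
    have hae := (e j).symm.aemeasurable_restrict htm subset_rfl
      ((haarK K).withDensity fun z => normAbs (η.coeff (e j) z))
    rw [Measure.map_apply_of_aemeasurable hae hA, Measure.restrict_apply' htm, inter_comm,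
      ← (e j).image_source_inter_eq', withDensity_apply]
    exact (e j).measurableSet_image ((e j).open_source.measurableSet.inter hA) inter_subset_left
  refine ⟨∑ j, ν j, fun φ hφ A hA hAφ => ?_⟩
  have hm (j : Fin r) : MeasurableSet ((e j).source ∩ A) :=
    (e j).open_source.measurableSet.inter hA
  have hsub (j : Fin r) : (e j).source ∩ A ⊆ φ.source := inter_subset_right.trans hAφ
  have hun : φ '' A = ⋃ j, φ '' ((e j).source ∩ A) := by
    rw [← image_iUnion, ← iUnion_inter, hcov, univ_inter]
  rw [Measure.finsetSum_apply, hun,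
    lintegral_iUnion (fun j => φ.measurableSet_image (hm j) (hsub j)), tsum_fintype]
  · exact Finset.sum_congr rfl fun j _ => (hν j hA).trans <|
      AnalyticOneForm.lintegral_chart_eq hπ hη hφ (he j).1 (hm j) (hsub j) inter_subset_left
  · intro j l hjl
    refine Set.disjoint_left.2 ?_
    rintro _ ⟨x, hx, rfl⟩ ⟨y, hy, hxy⟩
    exact Set.disjoint_left.1 (hdisj hjl) hx.1 (φ.injOn (hsub l hy) (hsub j hx) hxy ▸ hy.1)

theorem AnalyticOneForm.isVolume_measure (hπ : IsUniformiser π) (hη : η.NowhereVanishing) {r : ℕ}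
    (hr : IsDisjointUnionOfUnitBalls K X r) : η.IsVolume η.measure := by
  have h := AnalyticOneForm.exists_isVolume hπ hη hr
  rw [AnalyticOneForm.measure, dif_pos h]
  exact h.choose_spec

/-- The total volume of a disjoint union of `r` copies of `O_K` is congruent to `r`. -/
theorem AnalyticOneForm.IsVolume.exists_univ (hπ : IsUniformiser π) (hη : η.NowhereVanishing)
    {μ : Measure X} (hμ : η.IsVolume μ) {r : ℕ} (hr : IsDisjointUnionOfUnitBalls K X r) :
    μ univ ≠ ⊤ ∧ CongrMod (residueCard K - 1) (μ.real univ) (r : ZMod (residueCard K - 1)) := by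
  obtain ⟨e, he, hdisj, hcov⟩ := hr
  have h (j : Fin r) : IsUnitVolume K (μ (e j).source) :=
    hμ.isUnitVolume hπ hη (he j).1 (e j).open_source.measurableSet subset_rfl (a := 0) (k := 0)
      (by rw [(e j).image_source_eq_target, (he j).2, zpow_zero])
  choose v hv0 hv hvc using h
  have hun : μ univ = ENNReal.ofReal (∑ j, v j) := by
    rw [← hcov, measure_iUnion hdisj fun j => (e j).open_source.measurableSet, tsum_fintype,
      ENNReal.ofReal_sum_of_nonneg fun i _ => (hv0 i).le]
    exact Finset.sum_congr rfl fun j _ => hv j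
  refine ⟨hun ▸ ENNReal.ofReal_ne_top, ?_⟩
  rw [Measure.real, hun, ENNReal.toReal_ofReal (Finset.sum_nonneg fun j _ => (hv0 j).le)]
  simpa using CongrMod.sum Finset.univ fun j _ => hvc j

end Volume

/-! ### The Serre invariant of the Tate curve -/

section Decomposition

variable {K : Type*} [NontriviallyNormedField K] {X : Type*} [TopologicalSpace X]
  [ChartedSpace K X]

theorem isDisjointUnionOfUnitBalls_of_fintype {ι : Type*} [Fintype ι]
    (e : ι → OpenPartialHomeomorph X K)
    (he : ∀ j, e j ∈ analyticCharts K X ∧ (e j).target = closedBall (0 : K) 1)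
    (hdisj : Pairwise fun j l => Disjoint (e j).source (e l).source)
    (hcov : (⋃ j, (e j).source) = univ) :
    IsDisjointUnionOfUnitBalls K X (Fintype.card ι) := by
  let σ := (Fintype.equivFin ι).symm
  refine ⟨fun j => e (σ j), fun j => he _, fun j l hjl => hdisj (σ.injective.ne hjl), ?_⟩
  rw [← hcov]
  exact σ.surjective.iUnion_comp fun j => (e j).source

theorem trans_mem_analyticCharts {φ : OpenPartialHomeomorph X K} (hφ : φ ∈ analyticCharts K X)
    {g : OpenPartialHomeomorph K K} (hg : g ∈ contDiffGroupoid ω 𝓘(K, K)) :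
    φ.trans g ∈ analyticCharts K X := by
  intro ψ hψ
  have h := hφ ψ hψ
  refine ⟨?_, ?_⟩
  · rw [OpenPartialHomeomorph.trans_symm_eq_symm_trans_symm, OpenPartialHomeomorph.trans_assoc]
    exact StructureGroupoid.trans _ (StructureGroupoid.symm _ hg) h.1
  · rw [← OpenPartialHomeomorph.trans_assoc]
    exact StructureGroupoid.trans _ h.2 hg

end Decomposition

/-- The affine homeomorphism `z ↦ (z - a) c⁻¹`. -/
def rescaleHomeomorph {K : Type*} [NontriviallyNormedField K] (a : K) {c : K} (hc : c ≠ 0) :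
    K ≃ₜ K :=
  (Homeomorph.addRight (-a)).trans (Homeomorph.mulRight₀ c⁻¹ (inv_ne_zero hc))

theorem rescaleHomeomorph_mem_contDiffGroupoid {K : Type*} [NontriviallyNormedField K] (a : K)
    {c : K} (hc : c ≠ 0) :
    (rescaleHomeomorph a hc).toOpenPartialHomeomorph ∈ contDiffGroupoid ω 𝓘(K, K) := by
  rw [mem_contDiffGroupoid_iff]
  constructor
  · have : ContDiff K ω fun z : K => (z + -a) * c⁻¹ :=
      (contDiff_id.add contDiff_const).mul contDiff_const
    exact this.contDiffOn
  · have : ContDiff K ω fun z : K => z * (c⁻¹)⁻¹ + - -a :=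
      (contDiff_id.mul contDiff_const).add contDiff_const
    exact this.contDiffOn

namespace TateCurve

variable {K : Type*} [NontriviallyNormedField K] [IsUltrametricDist K] (t : TateParameter K)

/-- The norm is constant on this ball, while a nontrivial power of `t` changes it. -/
theorem injOn_mk (v : Kˣ) : InjOn (mk t) {w : Kˣ | ‖(w : K) - v‖ < ‖(v : K)‖} := by
  intro a ha b hb hab
  obtain ⟨n, rfl⟩ := (mk_eq_mk t).1 hab
  have h1 := norm_eq_of_near ha
  have h2 := norm_eq_of_near hb
  have h3 : ‖(t.val : K)‖ ^ n = 1 := by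
    have : ‖(a : K)‖ * ‖(t.val : K)‖ ^ n = ‖(a : K)‖ * 1 := by
      rw [mul_one, ← norm_zpow, ← norm_mul, h1, ← h2]
      simp
    exact mul_left_cancel₀ (norm_ne_zero_iff.2 a.ne_zero) this
  simp [norm_zpow_eq_one t h3]

theorem exists_isUniformising_ball (v : Kˣ) :
    ∃ ξ : OpenPartialHomeomorph (TateCurve t) K, IsUniformising t ξ ∧
      ξ.source = mk t '' {w : Kˣ | ‖(w : K) - v‖ < ‖(v : K)‖} ∧
      ξ.target = ball (v : K) ‖(v : K)‖ := by
  let S : Set Kˣ := {w | ‖(w : K) - v‖ < ‖(v : K)‖}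
  have hS : IsOpen S :=
    isOpen_lt ((Units.continuous_val.sub continuous_const).norm) continuous_const
  have : Nonempty Kˣ := ⟨1⟩
  let e : OpenPartialHomeomorph Kˣ (TateCurve t) :=
    OpenPartialHomeomorph.ofContinuousOpen ((injOn_mk t v).toPartialEquiv (mk t) S)
      (continuous_mk t).continuousOn (isOpenMap_mk t) hS
  let i : OpenPartialHomeomorph Kˣ K :=
    (Units.isOpenEmbedding_val (R := K)).toOpenPartialHomeomorph _
  have hsrc : (e.symm.trans i).source = mk t '' S := by
    rw [OpenPartialHomeomorph.trans_source]
    change e.target ∩ e.symm ⁻¹' univ = _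
    rw [preimage_univ, inter_univ]
    rfl
  refine ⟨e.symm.trans i, fun x hx => ?_, hsrc, ?_⟩
  · have hx' : x ∈ e.target := by
      rw [OpenPartialHomeomorph.trans_source] at hx
      exact hx.1
    exact ⟨e.symm x, rfl, e.right_inv hx'⟩
  · rw [← OpenPartialHomeomorph.image_source_eq_target, hsrc]
    have hes (w : Kˣ) (hw : w ∈ S) : (e.symm.trans i) (mk t w) = w := by
      have : e.symm (e w) = w := e.left_inv hw
      exact congrArg Units.val this
    ext z
    constructor
    · rintro ⟨_, ⟨w, hw, rfl⟩, rfl⟩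
      rw [hes w hw, mem_ball, dist_eq_norm]
      exact hw
    · intro hz
      rw [mem_ball, dist_eq_norm] at hz
      have hz0 : z ≠ 0 := by
        rintro rfl
        simp at hz
      exact ⟨_, ⟨Units.mk0 z hz0, hz, rfl⟩, hes _ hz⟩

/-- The image of the ball of radius `‖π v‖` around `v` is the domain of an analytic chart onto
`O_K`. -/
theorem exists_unitBall_chart {π : K} (hπ : IsUniformiser π) (v : Kˣ) :
    ∃ e ∈ analyticCharts K (TateCurve t),
      e.target = closedBall (0 : K) 1 ∧
      e.source = mk t '' {w : Kˣ | ‖(w : K) - v‖ < ‖(v : K)‖} := by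
  obtain ⟨ξ, hξ, hsrc, htgt⟩ := exists_isUniformising_ball t v
  -- The open ball of radius `‖v‖` is the closed ball of radius `‖v * π‖`, so `z ↦ (z - v) / (v *
  -- π)` carries it onto `O_K`.
  have hc : (v : K) * π ≠ 0 := mul_ne_zero v.ne_zero hπ.ne_zero
  have hv : 0 < ‖(v : K)‖ := norm_pos_iff.2 v.ne_zero
  have hξ' : ξ ∈ analyticCharts K (TateCurve t) :=
    IsManifold.subset_maximalAtlas (show ξ ∈ atlas K (TateCurve t) from hξ)
  refine ⟨_, trans_mem_analyticCharts hξ' (rescaleHomeomorph_mem_contDiffGroupoid (v : K) hc),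
    ?_, ?_⟩
  · rw [OpenPartialHomeomorph.trans_target, htgt]
    ext z
    have : (rescaleHomeomorph (v : K) hc).symm z = z * (v * π) + v := by
      change z * ((v * π)⁻¹)⁻¹ + - -(v : K) = _
      rw [inv_inv, neg_neg]
    change z ∈ univ ∧ (rescaleHomeomorph (v : K) hc).symm z ∈ ball (v : K) ‖(v : K)‖ ↔ _
    rw [this, mem_ball, mem_closedBall, dist_eq_norm, dist_eq_norm, add_sub_cancel_right, sub_zero,
      norm_mul, norm_mul]
    simp only [mem_univ, true_and]
    constructor
    · intro h
      by_contra! h1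
      have h2 := hπ.norm_le z⁻¹ (by rw [norm_inv]; exact inv_lt_one_of_one_lt₀ h1)
      rw [norm_inv, inv_le_iff_one_le_mul₀ (by linarith)] at h2
      nlinarith
    · intro h
      have := hπ.lt_one
      have := hπ.pos
      have h3 : ‖z‖ * ‖π‖ < 1 := by nlinarith [norm_nonneg z]
      calc ‖z‖ * (‖(v : K)‖ * ‖π‖) = ‖(v : K)‖ * (‖z‖ * ‖π‖) := by ring
        _ < ‖(v : K)‖ := mul_lt_of_lt_one_right hv h3
  · rw [OpenPartialHomeomorph.trans_source, hsrc]
    change _ ∩ ξ ⁻¹' univ = _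
    rw [preimage_univ, inter_univ]

/-- With `‖t‖ = ‖π‖ ^ n`, the shells `‖v‖ = ‖π‖ ^ k` for `0 ≤ k < n` represent `Kˣ / t^ℤ`. Each is a
union of `q - 1` balls, one for each nonzero leading coefficient, so `r = n(q - 1)`. -/
theorem exists_isDisjointUnionOfUnitBalls [ProperSpace K] {π : K} (hπ : IsUniformiser π) :
    ∃ r : ℕ, IsDisjointUnionOfUnitBalls K (TateCurve t) r ∧
      (r : ZMod (residueCard K - 1)) = 0 := by
  classical
  have := finite_residueField (K := K)
  have := Fintype.ofFinite 𝓀[K]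
  have : DecidableEq 𝓀[K] := Classical.decEq _
  obtain ⟨n, hn⟩ := hπ.norm_eq_zpow t.val.ne_zero
  have hn0 : 0 < n := by
    have h := t.norm_lt_one
    rw [hn] at h
    by_contra! hn'
    exact absurd h (not_lt.2 (one_le_zpow_of_nonpos₀ hπ.pos hπ.lt_one.le hn'))
  lift n to ℕ using hn0.le
  have hrep (i : {i : 𝓀[K] // i ≠ 0}) : ‖residueRep K i.1‖ = 1 := by
    refine (norm_residueRep_le i.1).antisymm (not_lt.1 fun h => i.2 ?_)
    have h2 := (norm_sub_residueRep_lt_one_iff (0 : 𝒪[K]) i.1).1 (by simpa using h)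
    rw [← h2, map_zero]
  let b (j : Fin n × {i : 𝓀[K] // i ≠ 0}) : Kˣ :=
    Units.mk0 (π ^ (j.1 : ℕ) * residueRep K j.2.1) <|
      mul_ne_zero (pow_ne_zero _ hπ.ne_zero) (norm_pos_iff.1 ((hrep j.2).symm ▸ one_pos))
  have hb (j) : ‖(b j : K)‖ = ‖π‖ ^ ((j.1 : ℕ) : ℤ) := by
    simp [b, hrep j.2]
  -- the balls in terms of the leading coefficient
  have hlead (j) (w : Kˣ) (hw : ‖(w : K) - b j‖ < ‖(b j : K)‖) :
      ‖(w : K) / π ^ (j.1 : ℕ)‖ ≤ 1 ∧ ‖(w : K) / π ^ (j.1 : ℕ) - residueRep K j.2.1‖ < 1 := by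
    have hp : π ^ (j.1 : ℕ) ≠ 0 := pow_ne_zero _ hπ.ne_zero
    have hp' : 0 < ‖π‖ ^ (j.1 : ℕ) := pow_pos hπ.pos _
    constructor
    · rw [norm_div, norm_eq_of_near hw, hb, norm_pow, zpow_natCast, div_self hp'.ne']
    · have : (w : K) / π ^ (j.1 : ℕ) - residueRep K j.2.1 = (w - b j) / π ^ (j.1 : ℕ) := by
        rw [sub_div]
        simp [b, hp]
      rw [this, norm_div, norm_pow, div_lt_one hp']
      rwa [hb, zpow_natCast] at hw
  choose e he htgt hsrc using fun j => exists_unitBall_chart t hπ (b j)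
  refine ⟨_, isDisjointUnionOfUnitBalls_of_fintype e (fun j => ⟨he j, htgt j⟩) ?_ ?_, ?_⟩
  · intro j l hjl
    refine Set.disjoint_left.2 fun x hj hl => hjl ?_
    rw [hsrc] at hj hl
    obtain ⟨v, hv, rfl⟩ := hj
    obtain ⟨w, hw, hvw⟩ := hl
    obtain ⟨m, rfl⟩ := (mk_eq_mk t).1 hvw
    have h1 := norm_eq_of_near hv
    have h2 := norm_eq_of_near hw
    rw [hb] at h1 h2
    have h3 : ((j.1 : ℕ) : ℤ) = (l.1 : ℕ) + n * m := by
      refine zpow_right_injective₀ hπ.pos hπ.lt_one.ne ?_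
      change ‖π‖ ^ ((j.1 : ℕ) : ℤ) = ‖π‖ ^ (((l.1 : ℕ) : ℤ) + n * m)
      rw [← h1, zpow_add₀ hπ.pos.ne', ← h2, zpow_mul, ← hn]
      simp
    have hj := j.1.2
    have hl := l.1.2
    -- Both shell indices lie in `[0, n)`, so they cannot differ by a nonzero multiple of `n`.
    have hm : m = 0 := by
      by_contra hm
      rcases lt_or_gt_of_ne hm with h | h
      · nlinarith
      · nlinarith
    subst hm
    have h4 : (j.1 : ℕ) = l.1 := by omega
    have h5 := hlead j _ hv
    have h6 := hlead l _ hw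
    simp only [zpow_zero, mul_one] at h5 h6
    rw [← h4] at h6
    have h7 := (norm_sub_residueRep_lt_one_iff
      (⟨_, Valued.integer.mem_iff.2 h5.1⟩ : 𝒪[K]) _).1 h5.2
    have h8 := (norm_sub_residueRep_lt_one_iff
      (⟨_, Valued.integer.mem_iff.2 h5.1⟩ : 𝒪[K]) _).1 h6.2
    exact Prod.ext (Fin.ext h4) (Subtype.ext (h7.symm.trans h8))
  · refine eq_univ_of_forall fun x => ?_
    obtain ⟨v, rfl⟩ : ∃ v, mk t v = x :=
      QuotientGroup.mk_surjective (s := Subgroup.zpowers t.val) x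
    obtain ⟨m, hm⟩ := hπ.norm_eq_zpow v.ne_zero
    obtain ⟨w, hwx, k, hw⟩ : ∃ w : Kˣ, mk t v = mk t w ∧
        ∃ k : Fin n, ‖(w : K)‖ = ‖π‖ ^ (k : ℕ) := by
      have h1 := Int.emod_nonneg m hn0.ne'
      have h2 := Int.emod_lt_of_pos m hn0
      -- Division with remainder of the valuation by `n` moves `v` into the fundamental domain.
      refine ⟨v * t.val ^ (-(m / n)), (mk_eq_mk t).2 ⟨_, rfl⟩, ⟨(m % n).toNat, by omega⟩, ?_⟩
      rw [← zpow_natCast, Int.toNat_of_nonneg h1, Int.emod_def, sub_eq_add_neg,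
        zpow_add₀ hπ.pos.ne', ← hm, ← mul_neg, zpow_mul, ← hn]
      simp
    have hp : π ^ (k : ℕ) ≠ 0 := pow_ne_zero _ hπ.ne_zero
    have hp' : 0 < ‖π‖ ^ (k : ℕ) := pow_pos hπ.pos _
    have hunit : ‖(w : K) / π ^ (k : ℕ)‖ = 1 := by
      rw [norm_div, hw, norm_pow, div_self hp'.ne']
    let z : 𝒪[K] := ⟨(w : K) / π ^ (k : ℕ), Valued.integer.mem_iff.2 hunit.le⟩
    have hz0 : IsLocalRing.residue 𝒪[K] z ≠ 0 := fun h =>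
      ((norm_lt_one_iff_residue_eq_zero z).2 h).ne hunit
    have hz := (norm_sub_residueRep_lt_one_iff z (IsLocalRing.residue 𝒪[K] z)).2 rfl
    refine mem_iUnion.2 ⟨(k, ⟨_, hz0⟩), ?_⟩
    rw [hsrc]
    refine ⟨w, ?_, hwx.symm⟩
    rw [mem_ofPred_eq, hb, zpow_natCast]
    have : (w : K) - b (k, ⟨_, hz0⟩) =
        π ^ (k : ℕ) * ((z : K) - residueRep K (IsLocalRing.residue 𝒪[K] z)) := by
      rw [mul_sub, mul_div_cancel₀ _ hp]
      rfl
    rw [this, norm_mul, norm_pow]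
    exact mul_lt_of_lt_one_right hp' hz
  · rw [Fintype.card_prod, Fintype.card_subtype_compl, Fintype.card_subtype_eq, ← Nat.card_eq_fintype_card (α := 𝓀[K])]
    change ((_ * (residueCard K - 1) : ℕ) : ZMod (residueCard K - 1)) = 0
    simp

end TateCurve

/-- If the manifold carries a nowhere vanishing form and is a disjoint union of `r` copies of
`O_K`, then its Serre invariant is the class of `r`. -/
theorem IsDisjointUnionOfUnitBalls.hasSerreInvariant {K : Type*} [NontriviallyNormedField K]
    [IsUltrametricDist K] [ProperSpace K] [MeasurableSpace K] [BorelSpace K] {X : Type*}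
    [TopologicalSpace X] [ChartedSpace K X] [MeasurableSpace X] [BorelSpace X] {π : K}
    (hπ : IsUniformiser π) {η : AnalyticOneForm K X} (hη : η.NowhereVanishing) {r : ℕ}
    (hr : IsDisjointUnionOfUnitBalls K X r) : HasSerreInvariant K X r := by
  have hμ := AnalyticOneForm.isVolume_measure hπ hη hr
  -- Both `r'` and `r` are congruent to the same total volume.
  exact ⟨⟨r, hr⟩, fun r' hr' => (hμ.exists_univ hπ hη hr').2.unique (hμ.exists_univ hπ hη hr).2⟩

/-! ### The balls that contain a point of a given ball -/

section Balls

variable {K : Type*} [NontriviallyNormedField K] {X : Type*} [TopologicalSpace X]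

theorem OpenPartialHomeomorph.eq_source_inter_preimage_image (φ : OpenPartialHomeomorph X K)
    {B : Set X} (hB : B ⊆ φ.source) : B = φ.source ∩ φ ⁻¹' (φ '' B) := by
  refine Subset.antisymm (fun x hx => ⟨hB hx, mem_image_of_mem φ hx⟩) ?_
  rintro x ⟨hx, y, hy, hxy⟩
  exact φ.injOn (hB hy) hx hxy ▸ hy

variable {𝒜 : Set (OpenPartialHomeomorph X K)} {R : ℝ} {π : K} {B U : Set X}
  {θ : OpenPartialHomeomorph X K}

theorem IsUniformiser.isBall_iff (hπ : IsUniformiser π) :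
    IsBall 𝒜 R B ↔ ∃ φ ∈ 𝒜, ∃ (a : K) (k : ℤ), ‖π‖ ^ k ≤ R ∧ B ⊆ φ.source ∧
      φ '' B = closedBall a (‖π‖ ^ k) := by
  constructor
  · rintro ⟨φ, hφ, a, r, hr, hrR, hB, himg⟩
    obtain ⟨k, hk, hball⟩ := hπ.exists_closedBall_eq hr
    exact ⟨φ, hφ, a, k, hk.trans hrR, hB, himg.trans (hball a)⟩
  · rintro ⟨φ, hφ, a, k, hk, hB, himg⟩
    exact ⟨φ, hφ, a, _, hπ.zpow_pos k, hk, hB, himg⟩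

/-- The equalising condition enters through this lemma: the radius of a ball may be read off in any
chart of `𝒜` containing it. -/
theorem IsEqualisingAtlas.exists_image_eq [ChartedSpace K X] (h𝒜 : IsEqualisingAtlas 𝒜 R)
    {φ ψ : OpenPartialHomeomorph X K}
    (hφ : φ ∈ 𝒜) (hψ : ψ ∈ 𝒜) (hBφ : B ⊆ φ.source) (hBψ : B ⊆ ψ.source) {a : K} {r : ℝ}
    (hr : 0 < r) (hrR : r ≤ R) (himg : φ '' B = closedBall a r) :
    ∃ b, ψ '' B = closedBall b r := by
  obtain ⟨b, hb⟩ := h𝒜.equalising φ hφ ψ hψ a r hr hrR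
    (himg ▸ image_mono (subset_inter hBφ hBψ))
  refine ⟨b, ?_⟩
  rw [← hb, ← himg, image_image]
  exact image_congr fun x hx => by rw [φ.left_inv (hBφ hx)]

/-- The kernel depends on its two points only through the set of balls containing both. -/
theorem kernelZero_congr_of_isBall [MeasurableSpace X] (μ : Measure X) (s : ℝ) {x y x' y' : X}
    (h : ∀ B', IsBall 𝒜 R B' ∧ x ∈ B' ∧ y ∈ B' ↔ IsBall 𝒜 R B' ∧ x' ∈ B' ∧ y' ∈ B') :
    kernelZero 𝒜 R μ s x y = kernelZero 𝒜 R μ s x' y' := by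
  have hex : JoinExists 𝒜 R x y ↔ JoinExists 𝒜 R x' y' := exists_congr h
  have hjoin : join 𝒜 R x y = join 𝒜 R x' y' := by simp only [join, h]
  by_cases hx : JoinExists 𝒜 R x y
  · rw [kernelZero, kernelZero, if_pos hx, if_pos (hex.1 hx), hjoin]
  · rw [kernelZero, kernelZero, if_neg hx, if_neg (mt hex.2 hx)]

theorem kernelZero_comm [MeasurableSpace X] (μ : Measure X) (s : ℝ) (x y : X) :
    kernelZero 𝒜 R μ s x y = kernelZero 𝒜 R μ s y x := by
  have hiff (B' : Set X) : IsBall 𝒜 R B' ∧ x ∈ B' ∧ y ∈ B' ↔ IsBall 𝒜 R B' ∧ y ∈ B' ∧ x ∈ B' := by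
    rw [and_comm (a := x ∈ B')]
  exact kernelZero_congr_of_isBall μ s hiff

/-- The set `U` is a ball, with image of radius `‖π‖ ^ m` in the chart `θ`, that contains every
ball which meets `B`; and `B` is a ball of radius `‖π‖ ^ k` in `U`. -/
structure IsBallTower (𝒜 : Set (OpenPartialHomeomorph X K)) (R : ℝ) (π : K) (B U : Set X)
    (θ : OpenPartialHomeomorph X K) (m k : ℤ) : Prop where
  mem : θ ∈ 𝒜
  le : ‖π‖ ^ m ≤ R
  subset_source : U ⊆ θ.source
  image_large : ∀ x ∈ B, θ '' U = closedBall (θ x) (‖π‖ ^ m)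
  image_small : ∀ x ∈ B, θ '' B = closedBall (θ x) (‖π‖ ^ k)
  subset : B ⊆ U
  largest : ∀ x ∈ B, ∀ B', IsBall 𝒜 R B' → x ∈ B' → B' ⊆ U

/-- One `U` serves all of `B`: the largest ball at `x₀` contains `B`, hence `x`, so it lies in the
largest ball at `x`; that one then contains `x₀`, and maximality gives the reverse inclusion. -/
theorem exists_isBallTower [IsUltrametricDist K] [ChartedSpace K X] (hπ : IsUniformiser π)
    (h𝒜 : IsEqualisingAtlas 𝒜 R) {φ : OpenPartialHomeomorph X K} (hφ : φ ∈ 𝒜)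
    (hBφ : B ⊆ φ.source) {a : K} {k : ℤ} (hk : ‖π‖ ^ k ≤ R)
    (himg : φ '' B = closedBall a (‖π‖ ^ k))
    (hlarge : ∀ x ∈ B, ∃ U, IsLargestBall 𝒜 R x U) :
    ∃ U θ m, IsBallTower 𝒜 R π B U θ m k := by
  have hB : IsBall 𝒜 R B := hπ.isBall_iff.2 ⟨φ, hφ, a, k, hk, hBφ, himg⟩
  obtain ⟨x₀, hx₀, -⟩ : a ∈ φ '' B := himg ▸ mem_closedBall_self (hπ.zpow_pos k).le
  obtain ⟨U, hU, hxU, hmax⟩ := hlarge x₀ hx₀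
  have hBU : B ⊆ U := hmax B hB hx₀
  obtain ⟨θ, hθ, c, m, hm, hUθ, himgU⟩ := hπ.isBall_iff.1 hU
  obtain ⟨b, hb⟩ := h𝒜.exists_image_eq hφ hθ hBφ (hBU.trans hUθ) (hπ.zpow_pos k) hk himg
  refine ⟨U, θ, m, hθ, hm, hUθ, fun x hx => ?_, fun x hx => ?_, hBU, fun x hx B' hB' hxB' => ?_⟩
  · rw [himgU, IsUltrametricDist.closedBall_eq_of_mem (himgU ▸ mem_image_of_mem θ (hBU hx))]
  · rw [hb, IsUltrametricDist.closedBall_eq_of_mem (hb ▸ mem_image_of_mem θ hx)]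
  · obtain ⟨V, hV, hxV, hmaxV⟩ := hlarge x hx
    exact (hmaxV B' hB' hxB').trans (hmax V hV (hmaxV U hU (hBU hx) hxU))

namespace IsBallTower

/-- The points of `U` at distance at most `‖π‖ ^ k` from `x` in the chart `θ`. -/
def sub (π : K) (U : Set X) (θ : OpenPartialHomeomorph X K) (x : X) (k : ℤ) : Set X :=
  U ∩ θ ⁻¹' closedBall (θ x) (‖π‖ ^ k)

variable {m k l : ℤ} {x y : X}

theorem sub_mono (hπ : IsUniformiser π) (h : l ≤ k) : sub π U θ x k ⊆ sub π U θ x l :=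
  inter_subset_inter_right _ (preimage_mono (hπ.closedBall_subset_iff.2 h))

theorem mem_sub (hπ : IsUniformiser π) (hx : x ∈ U) : x ∈ sub π U θ x l :=
  ⟨hx, mem_closedBall_self (hπ.zpow_pos l).le⟩

theorem image_sub (hπ : IsUniformiser π) (h : IsBallTower 𝒜 R π B U θ m k) (hx : x ∈ B)
    (hl : m ≤ l) : θ '' sub π U θ x l = closedBall (θ x) (‖π‖ ^ l) := by
  rw [sub, image_inter_preimage, h.image_large x hx]
  exact inter_eq_right.2 (hπ.closedBall_subset_iff.2 hl)

theorem isBall_sub (hπ : IsUniformiser π) (h : IsBallTower 𝒜 R π B U θ m k) (hx : x ∈ B)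
    (hl : m ≤ l) : IsBall 𝒜 R (sub π U θ x l) :=
  hπ.isBall_iff.2 ⟨θ, h.mem, θ x, l, (hπ.zpow_le_zpow.2 hl).trans h.le,
    inter_subset_left.trans h.subset_source, h.image_sub hπ hx hl⟩

theorem sub_eq_large (h : IsBallTower 𝒜 R π B U θ m k) (hx : x ∈ B) : sub π U θ x m = U := by
  rw [sub, ← h.image_large x hx]
  exact inter_eq_left.2 (subset_preimage_image θ U)

theorem le_of_tower (hπ : IsUniformiser π) (h : IsBallTower 𝒜 R π B U θ m k) (hx : x ∈ B) :
    m ≤ k := by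
  rw [← hπ.closedBall_subset_iff (a := θ x), ← h.image_large x hx, ← h.image_small x hx]
  exact image_mono h.subset

theorem eq_sub_of_image (h : IsBallTower 𝒜 R π B U θ m k) {B' : Set X} (hB' : B' ⊆ U)
    (himg : θ '' B' = closedBall (θ x) (‖π‖ ^ l)) : B' = sub π U θ x l := by
  rw [sub, ← himg]
  refine Subset.antisymm (fun y hy => ⟨hB' hy, mem_image_of_mem θ hy⟩) fun y hy => ?_
  rw [θ.eq_source_inter_preimage_image (hB'.trans h.subset_source)]
  exact ⟨h.subset_source hy.1, hy.2⟩

theorem sub_eq_small (h : IsBallTower 𝒜 R π B U θ m k) (hx : x ∈ B) : sub π U θ x k = B :=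
  (h.eq_sub_of_image h.subset (h.image_small x hx)).symm

theorem not_joinExists (h : IsBallTower 𝒜 R π B U θ m k) (hx : x ∈ B) (hy : y ∉ U) :
    ¬ JoinExists 𝒜 R x y := by
  rintro ⟨B', hB', hxB', hyB'⟩
  exact hy (h.largest x hx B' hB' hxB' hyB')

theorem joinExists (hπ : IsUniformiser π) (h : IsBallTower 𝒜 R π B U θ m k) (hx : x ∈ B)
    (hy : y ∈ U) : JoinExists 𝒜 R x y :=
  ⟨U, h.sub_eq_large hx ▸ h.isBall_sub hπ hx le_rfl, h.subset hx, hy⟩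

theorem kernelZero_of_notMem [MeasurableSpace X] {μ : Measure X} {s : ℝ}
    (h : IsBallTower 𝒜 R π B U θ m k) (hx : x ∈ B) (hy : y ∉ U) :
    kernelZero 𝒜 R μ s x y = 1 := by
  rw [kernelZero, if_neg (h.not_joinExists hx hy)]

variable [IsUltrametricDist K] [ChartedSpace K X]

/-- The balls that contain a point `x` of `B` are the sets `sub π U θ x l`. -/
theorem exists_eq_sub (hπ : IsUniformiser π) (h𝒜 : IsEqualisingAtlas 𝒜 R)
    (h : IsBallTower 𝒜 R π B U θ m k) (hx : x ∈ B) {B' : Set X} (hB' : IsBall 𝒜 R B')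
    (hxB' : x ∈ B') : ∃ l, m ≤ l ∧ B' = sub π U θ x l := by
  have hB'U := h.largest x hx B' hB' hxB'
  obtain ⟨φ, hφ, a, l, hl, hB'φ, himg⟩ := hπ.isBall_iff.1 hB'
  obtain ⟨b, hb⟩ := h𝒜.exists_image_eq hφ h.mem hB'φ (hB'U.trans h.subset_source)
    (hπ.zpow_pos l) hl himg
  rw [IsUltrametricDist.closedBall_eq_of_mem (hb ▸ mem_image_of_mem θ hxB')] at hb
  refine ⟨l, ?_, h.eq_sub_of_image hB'U hb⟩
  rw [← hπ.closedBall_subset_iff (a := θ x), ← hb, ← h.image_large x hx]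
  exact image_mono hB'U

/-- The balls through `x` form a chain, so the join is the smallest one that still contains `y`. -/
theorem join_eq (hπ : IsUniformiser π) (h𝒜 : IsEqualisingAtlas 𝒜 R)
    (h : IsBallTower 𝒜 R π B U θ m k) (hx : x ∈ B) (hl : m ≤ l) (hy : y ∈ sub π U θ x l)
    (hy' : y ∉ sub π U θ x (l + 1)) : join 𝒜 R x y = sub π U θ x l := by
  refine Subset.antisymm (sInter_subset_of_mem
    ⟨h.isBall_sub hπ hx hl, mem_sub hπ (h.subset hx), hy⟩) (subset_sInter ?_)
  rintro B' ⟨hB', hxB', hyB'⟩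
  obtain ⟨n, hn, rfl⟩ := h.exists_eq_sub hπ h𝒜 hx hB' hxB'
  refine sub_mono hπ ?_
  by_contra! hln
  exact hy' (sub_mono hπ hln hyB')

/-- In the chain of balls through `x`, a ball that leaves `B` must contain `B`. Hence the points of
`B` cannot be told apart from outside. -/
theorem subset_of_isBall (hπ : IsUniformiser π) (h𝒜 : IsEqualisingAtlas 𝒜 R)
    (h : IsBallTower 𝒜 R π B U θ m k) (hx : x ∈ B) (hy : y ∉ B) {B' : Set X}
    (hB' : IsBall 𝒜 R B') (hxB' : x ∈ B') (hyB' : y ∈ B') : B ⊆ B' := by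
  obtain ⟨n, hn, rfl⟩ := h.exists_eq_sub hπ h𝒜 hx hB' hxB'
  rw [← h.sub_eq_small hx] at hy ⊢
  refine sub_mono hπ ?_
  by_contra! hkn
  exact hy (sub_mono hπ hkn.le hyB')

variable [MeasurableSpace X] {μ : Measure X} {s : ℝ}

theorem kernelZero_eq (hπ : IsUniformiser π) (h𝒜 : IsEqualisingAtlas 𝒜 R)
    (h : IsBallTower 𝒜 R π B U θ m k) (hx : x ∈ B) (hl : m ≤ l) (hy : y ∈ sub π U θ x l)
    (hy' : y ∉ sub π U θ x (l + 1)) :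
    kernelZero 𝒜 R μ s x y = μ.real (sub π U θ x l) ^ (-s) := by
  rw [kernelZero, if_pos (h.joinExists hπ hx hy.1), h.join_eq hπ h𝒜 hx hl hy hy']

/-- The kernel function at a point outside of `B` is constant on `B`. -/
theorem kernelZero_congr (hπ : IsUniformiser π) (h𝒜 : IsEqualisingAtlas 𝒜 R)
    (h : IsBallTower 𝒜 R π B U θ m k) {x' : X} (hx : x ∈ B) (hx' : x' ∈ B) (hy : y ∉ B) :
    kernelZero 𝒜 R μ s x y = kernelZero 𝒜 R μ s x' y := by
  have hiff (B' : Set X) : IsBall 𝒜 R B' ∧ x ∈ B' ∧ y ∈ B' ↔ IsBall 𝒜 R B' ∧ x' ∈ B' ∧ y ∈ B' :=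
    ⟨fun ⟨h1, h2, h3⟩ => ⟨h1, h.subset_of_isBall hπ h𝒜 hx hy h1 h2 h3 hx', h3⟩,
      fun ⟨h1, h2, h3⟩ => ⟨h1, h.subset_of_isBall hπ h𝒜 hx' hy h1 h2 h3 hx, h3⟩⟩
  exact kernelZero_congr_of_isBall μ s hiff

end IsBallTower

end Balls

/-! ### The operator on functions supported on a ball -/

/-- Measurability of `κ` is not assumed; it comes from constancy on finitely many layers. -/
theorem MeasureTheory.setIntegral_diff_of_const_on_layers {X : Type*} [MeasurableSpace X]
    {μ : Measure X} [IsFiniteMeasure μ] {D : ℕ → Set X} (hD : Monotone D)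
    (hm : ∀ i, MeasurableSet (D i)) {κ : X → ℝ} {c : ℕ → ℝ} (n : ℕ)
    (h : ∀ i < n, ∀ y ∈ D (i + 1) \ D i, κ y = c i) :
    IntegrableOn κ (D n \ D 0) μ ∧
      ∫ y in D n \ D 0, κ y ∂μ =
        ∑ i ∈ Finset.range n, c i * (μ.real (D (i + 1)) - μ.real (D i)) := by
  induction n with
  | zero => simp
  | succ n ih =>
    obtain ⟨ih1, ih2⟩ := ih fun i hi => h i (by omega)
    have hmd := (hm (n + 1)).diff (hm n)
    have hun : D (n + 1) \ D 0 = (D n \ D 0) ∪ (D (n + 1) \ D n) := by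
      have h1 := hD (Nat.zero_le n)
      have h2 := hD (Nat.le_succ n)
      ext y
      by_cases hy : y ∈ D n
      · simp [hy, h2 hy]
      · simpa [hy] using fun _ h0 => hy (h1 h0)
    have hdisj : Disjoint (D n \ D 0) (D (n + 1) \ D n) :=
      disjoint_sdiff_right.mono_left sdiff_subset
    have hint : IntegrableOn κ (D (n + 1) \ D n) μ :=
      (integrableOn_const (C := c n)).congr_fun (fun y hy => (h n (by omega) y hy).symm) hmd
    rw [hun, setIntegral_union hdisj hmd ih1 hint, ih2, Finset.sum_range_succ]
    refine ⟨ih1.union hint, ?_⟩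
    rw [setIntegral_congr_fun hmd (fun y hy => h n (by omega) y hy), setIntegral_const,
      smul_eq_mul, mul_comm, measureReal_sdiff (hD (Nat.le_succ n)) (hm n)]

section Operator

variable {K : Type*} [NontriviallyNormedField K] [IsUltrametricDist K] {X : Type*}
  [TopologicalSpace X]
  {𝒜 : Set (OpenPartialHomeomorph X K)} {R : ℝ} {π : K} {B U : Set X}
  {θ : OpenPartialHomeomorph X K} {m k : ℤ}

theorem IsBall.isOpen (hπ : IsUniformiser π) (hB : IsBall 𝒜 R B) : IsOpen B := by
  obtain ⟨φ, -, a, l, -, hBφ, himg⟩ := hπ.isBall_iff.1 hB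
  rw [φ.eq_source_inter_preimage_image hBφ, himg]
  exact φ.isOpen_inter_preimage (hπ.isOpen_closedBall a l)

variable [ChartedSpace K X]

/-- The value of the operator outside of the ball which supports the function. -/
theorem IsBallTower.laplaceZero_of_notMem [MeasurableSpace X] (μ : Measure X)
    (hπ : IsUniformiser π) (h𝒜 : IsEqualisingAtlas 𝒜 R)
    (h : IsBallTower 𝒜 R π B U θ m k) {x₀ x : X} (hx₀ : x₀ ∈ B) (hx : x ∉ B) (s : ℝ) {u : X → ℂ}
    (hu0 : ∀ y ∉ B, u y = 0) :
    laplaceZero 𝒜 R μ s u x = -(kernelZero 𝒜 R μ s x x₀ : ℂ) * ∫ y, u y ∂μ := by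
  rw [laplaceZero, ← integral_const_mul]
  congr 1
  ext y
  rw [hu0 x hx, zero_sub]
  by_cases hy : y ∈ B
  · rw [kernelZero_comm μ s x y, h.kernelZero_congr hπ h𝒜 hy hx₀ hx, kernelZero_comm μ s x₀ x]
    ring
  · rw [hu0 y hy]
    ring

variable [MeasurableSpace X] [OpensMeasurableSpace X] (μ : Measure X) [IsFiniteMeasure μ]

namespace IsBallTower

/-- The integral of the kernel function over the complement of `B`, computed along the chain of
balls from `B` to `U`. -/
def outerSum (μ : Measure X) (π : K) (U : Set X) (θ : OpenPartialHomeomorph X K) (m k : ℤ) (x : X)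
    (s : ℝ) : ℝ :=
  (∑ i ∈ Finset.range (k - m).toNat, μ.real (sub π U θ x (k - (i + 1))) ^ (-s) *
    (μ.real (sub π U θ x (k - (i + 1))) - μ.real (sub π U θ x (k - i)))) + μ.real Uᶜ

theorem setIntegral_compl_kernelZero (hπ : IsUniformiser π) (h𝒜 : IsEqualisingAtlas 𝒜 R)
    (h : IsBallTower 𝒜 R π B U θ m k) {x : X} (hx : x ∈ B) (s : ℝ) :
    IntegrableOn (fun y => kernelZero 𝒜 R μ s x y) Bᶜ μ ∧
      ∫ y in Bᶜ, kernelZero 𝒜 R μ s x y ∂μ = outerSum μ π U θ m k x s := by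
  have hmk := h.le_of_tower hπ hx
  have hUm : MeasurableSet U :=
    (IsBall.isOpen hπ (h.sub_eq_large hx ▸ h.isBall_sub hπ hx le_rfl)).measurableSet
  have hm (i : ℕ) : MeasurableSet (sub π U θ x (k - i)) := by
    have : sub π U θ x (k - i) = U ∩ (θ.source ∩ θ ⁻¹' closedBall (θ x) (‖π‖ ^ (k - i))) := by
      rw [← inter_assoc, inter_eq_left.2 h.subset_source]
      rfl
    rw [this]
    exact hUm.inter (θ.isOpen_inter_preimage (hπ.isOpen_closedBall _ _)).measurableSet
  have hmono : Monotone fun i : ℕ => sub π U θ x (k - i) := fun i j hij =>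
    sub_mono hπ (by omega)
  have h0 : sub π U θ x (k - (0 : ℕ)) = B := by simpa using h.sub_eq_small hx
  -- The index counts steps outwards: 0 gives `B`, and `k - m` gives `U`.
  have hn : sub π U θ x (k - ((k - m).toNat : ℕ)) = U := by
    rw [Int.toNat_of_nonneg (by omega), sub_sub_cancel]
    exact h.sub_eq_large hx
  obtain ⟨h1, h2⟩ := setIntegral_diff_of_const_on_layers (μ := μ) hmono hm
    (κ := fun y => kernelZero 𝒜 R μ s x y)
    (c := fun i => μ.real (sub π U θ x (k - (i + 1))) ^ (-s)) (k - m).toNat fun i hi y hy => by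
      refine h.kernelZero_eq hπ h𝒜 hx (by omega) (by simpa using hy.1) ?_
      convert hy.2 using 3
      ring
  rw [h0, hn] at h1 h2
  have hBU := h.subset
  have hun : Bᶜ = (U \ B) ∪ Uᶜ := by
    ext y
    by_cases hy : y ∈ U
    · simp [hy]
    · simpa [hy] using fun hb => hy (hBU hb)
  have hdisj : Disjoint (U \ B) Uᶜ :=
    (disjoint_compl_right (a := U)).mono_left sdiff_subset
  have hk : ∀ y ∈ Uᶜ, kernelZero 𝒜 R μ s x y = 1 := fun y hy => h.kernelZero_of_notMem hx hy
  have hint : IntegrableOn (fun y => kernelZero 𝒜 R μ s x y) Uᶜ μ :=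
    (integrableOn_const (C := (1 : ℝ))).congr_fun (fun y hy => (hk y hy).symm) hUm.compl
  rw [hun, setIntegral_union hdisj hUm.compl h1 hint, h2, setIntegral_congr_fun hUm.compl hk]
  refine ⟨h1.union hint, ?_⟩
  rw [outerSum, setIntegral_const]
  simp

/-- The value of the operator at a point of the ball which supports the function. -/
theorem laplaceZero_of_mem (hπ : IsUniformiser π) (h𝒜 : IsEqualisingAtlas 𝒜 R)
    (h : IsBallTower 𝒜 R π B U θ m k) {x₀ x : X} (hx₀ : x₀ ∈ B) (hx : x ∈ B) (s : ℝ) {u : X → ℂ}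
    (hu : Integrable u μ) (hu0 : ∀ y ∉ B, u y = 0)
    (huc : ∀ y ∈ sub π U θ x (k + 1), u y = u x) :
    laplaceZero 𝒜 R μ s u x = u x * (outerSum μ π U θ m k x₀ s : ℝ) +
      (μ.real B ^ (-s) : ℝ) * (u x * (μ.real B : ℝ) - ∫ y, u y ∂μ) := by
  have hmk := h.le_of_tower hπ hx
  have hBm : MeasurableSet B :=
    (IsBall.isOpen hπ (h.sub_eq_small hx ▸ h.isBall_sub hπ hx hmk)).measurableSet
  obtain ⟨h1, h2⟩ := h.setIntegral_compl_kernelZero μ hπ h𝒜 hx₀ s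
  -- Either `y` lies in the next smaller ball around `x` and the difference vanishes, or the join is
  -- `B`.
  have hin : ∀ y ∈ B, (kernelZero 𝒜 R μ s x y : ℂ) * (u x - u y) =
      (μ.real B ^ (-s) : ℝ) * (u x - u y) := by
    intro y hy
    by_cases hy' : y ∈ sub π U θ x (k + 1)
    · rw [huc y hy', sub_self, mul_zero, mul_zero]
    · have hB := h.sub_eq_small hx
      rw [h.kernelZero_eq hπ h𝒜 hx hmk (by rwa [hB]) hy', hB]
  have hout : ∀ y ∈ Bᶜ, (kernelZero 𝒜 R μ s x y : ℂ) * (u x - u y) =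
      (kernelZero 𝒜 R μ s x₀ y : ℂ) * u x := by
    intro y hy
    rw [hu0 y hy, sub_zero, h.kernelZero_congr hπ h𝒜 hx hx₀ hy]
  have hi1 : IntegrableOn (fun y => u x - u y) B μ :=
    ((integrable_const (u x)).sub hu).integrableOn
  have hi1' : IntegrableOn (fun y => (kernelZero 𝒜 R μ s x y : ℂ) * (u x - u y)) B μ :=
    IntegrableOn.congr_fun (hi1.const_mul _) (fun y hy => (hin y hy).symm) hBm
  have hi2 : IntegrableOn (fun y => (kernelZero 𝒜 R μ s x y : ℂ) * (u x - u y)) Bᶜ μ :=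
    IntegrableOn.congr_fun (h1.ofReal.mul_const (u x)) (fun y hy => (hout y hy).symm) hBm.compl
  have hMu : ∫ y in B, u y ∂μ = ∫ y, u y ∂μ :=
    setIntegral_eq_integral_of_forall_compl_eq_zero hu0
  have hfull : IntegrableOn (fun y => (kernelZero 𝒜 R μ s x y : ℂ) * (u x - u y)) univ μ := by
    rw [← union_compl_self B]
    exact hi1'.union hi2
  rw [laplaceZero, ← integral_add_compl hBm (integrableOn_univ.1 hfull),
    setIntegral_congr_fun hBm hin, setIntegral_congr_fun hBm.compl hout, integral_const_mul,
    integral_mul_const, integral_sub (integrable_const _) hu.integrableOn, hMu, setIntegral_const,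
    integral_complex_ofReal, h2, Complex.real_smul, mul_comm (u x), mul_comm (u x), add_comm]

/-- An eigenvalue of a function that is supported on `B`, constant on the next smaller balls, but
not on `B`. -/
theorem eigenvalue_eq (hπ : IsUniformiser π) (h𝒜 : IsEqualisingAtlas 𝒜 R)
    (h : IsBallTower 𝒜 R π B U θ m k) {x₀ x₁ : X} (hx₀ : x₀ ∈ B) (hx₁ : x₁ ∈ B) (s : ℝ) {u : X → ℂ}
    (hu : Integrable u μ) (hu0 : ∀ y ∉ B, u y = 0)
    (huc : ∀ x ∈ B, ∀ y ∈ sub π U θ x (k + 1), u y = u x) (hne : u x₁ ≠ u x₀) {lam : ℂ}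
    (hlam : HasWaveletEigenvalue 𝒜 R μ s u lam) :
    lam = (outerSum μ π U θ m k x₀ s + μ.real B * μ.real B ^ (-s) : ℝ) := by
  have e0 := h.laplaceZero_of_mem μ hπ h𝒜 hx₀ hx₀ s hu hu0 (huc x₀ hx₀)
  have e1 := h.laplaceZero_of_mem μ hπ h𝒜 hx₀ hx₁ s hu hu0 (huc x₁ hx₁)
  rw [hlam] at e0 e1
  -- The integral of `u` enters the values at `x₀` and `x₁` in the same way and cancels in the
  -- difference, so no mean-zero hypothesis is needed.
  refine mul_right_cancel₀ (sub_ne_zero.2 hne) ?_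
  push_cast
  linear_combination e1 - e0

theorem hasWaveletEigenvalue_of_integral_eq_zero (hπ : IsUniformiser π)
    (h𝒜 : IsEqualisingAtlas 𝒜 R) (h : IsBallTower 𝒜 R π B U θ m k) {x₀ : X} (hx₀ : x₀ ∈ B) (s : ℝ)
    {u : X → ℂ} (hu : Integrable u μ) (hu0 : ∀ y ∉ B, u y = 0)
    (huc : ∀ x ∈ B, ∀ y ∈ sub π U θ x (k + 1), u y = u x) (hint : ∫ y, u y ∂μ = 0) :
    HasWaveletEigenvalue 𝒜 R μ s u
      (outerSum μ π U θ m k x₀ s + μ.real B * μ.real B ^ (-s) : ℝ) := by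
  intro x
  by_cases hx : x ∈ B
  · rw [h.laplaceZero_of_mem μ hπ h𝒜 hx₀ hx s hu hu0 (huc x hx), hint]
    push_cast
    ring
  · rw [h.laplaceZero_of_notMem μ hπ h𝒜 hx₀ hx s hu0, hint, hu0 x hx, mul_zero, mul_zero]

end IsBallTower

end Operator

/-! ### The eigenvalue modulo `q - 1` -/

theorem ExpSumCongrMod.of_fintype {N : ℕ} {ι : Type*} [Fintype ι] (c m : ι → ℝ) (γ : ι → ZMod N)
    (hc : ∀ j, CongrMod N (c j) (γ j)) (hm : ∀ j, 0 < m j ∧ CongrMod N (m j) 1) :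
    ExpSumCongrMod N (fun s => ∑ j, c j * m j ^ (-s)) (∑ j, γ j) := by
  let σ := (Fintype.equivFin ι).symm
  exact ⟨Fintype.card ι, c ∘ σ, m ∘ σ, γ ∘ σ, fun j => hc _, fun j => hm _,
    fun s => (σ.sum_comp fun j => c j * m j ^ (-s)).symm, σ.sum_comp γ⟩

section Congruence

variable {K : Type*} [NontriviallyNormedField K] [IsUltrametricDist K] [ProperSpace K]
  [MeasurableSpace K] [BorelSpace K] {X : Type*} [TopologicalSpace X] [ChartedSpace K X]
  [MeasurableSpace X] [OpensMeasurableSpace X]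
  {𝒜 : Set (OpenPartialHomeomorph X K)} {R : ℝ} {π : K} {B U : Set X}
  {θ : OpenPartialHomeomorph X K} {m k : ℤ} {η : AnalyticOneForm K X} {μ : Measure X}

theorem IsBall.measureReal (hπ : IsUniformiser π) (h𝒜 : IsEqualisingAtlas 𝒜 R)
    (hη : η.NowhereVanishing) (hμ : η.IsVolume μ) (hB : IsBall 𝒜 R B) :
    0 < μ.real B ∧ CongrMod (residueCard K - 1) (μ.real B) 1 := by
  have hBm := (IsBall.isOpen hπ hB).measurableSet
  obtain ⟨φ, hφ, a, l, -, hBφ, himg⟩ := hπ.isBall_iff.1 hB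
  obtain ⟨v, hv, he, hc⟩ := hμ.isUnitVolume hπ hη (h𝒜.analytic hφ) hBm hBφ himg
  rw [Measure.real, he, ENNReal.toReal_ofReal hv.le]
  exact ⟨hv, hc⟩

/-- The eigenvalue of a wavelet, as a function of the exponent, is congruent to the total volume. -/
theorem IsBallTower.expSumCongrMod [IsFiniteMeasure μ] (hπ : IsUniformiser π)
    (h𝒜 : IsEqualisingAtlas 𝒜 R)
    (hη : η.NowhereVanishing) (hμ : η.IsVolume μ) (h : IsBallTower 𝒜 R π B U θ m k) {x : X}
    (hx : x ∈ B) {i : ZMod (residueCard K - 1)}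
    (hi : CongrMod (residueCard K - 1) (μ.real univ) i) :
    ExpSumCongrMod (residueCard K - 1)
      (fun s => outerSum μ π U θ m k x s + μ.real B * μ.real B ^ (-s)) i := by
  have hmk := h.le_of_tower hπ hx
  have hUb : IsBall 𝒜 R U := h.sub_eq_large hx ▸ h.isBall_sub hπ hx le_rfl
  have hBb : IsBall 𝒜 R B := h.sub_eq_small hx ▸ h.isBall_sub hπ hx hmk
  have hsub (l : ℤ) (hl : m ≤ l) := (h.isBall_sub hπ hx hl).measureReal hπ h𝒜 hη hμ
  have hB := hBb.measureReal hπ h𝒜 hη hμ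
  have hU := hUb.measureReal hπ h𝒜 hη hμ
  have hUc : CongrMod (residueCard K - 1) (μ.real Uᶜ) (i - 1) := by
    rw [measureReal_compl (IsBall.isOpen hπ hUb).measurableSet]
    exact hi.sub hU.2
  let D (i : ℕ) : Set X := sub π U θ x (k - i)
  let n := (k - m).toNat
  have hD (i : ℕ) (hin : i ≤ n) := hsub (k - i) (by omega)
  -- The three kinds of index stand for `B`, for the complement of `U` (with base 1), and for the
  -- layers; their coefficients have classes `1`, `i - 1` and `0`.
  have key := ExpSumCongrMod.of_fintype (N := residueCard K - 1)
    (ι := Option (Option (Fin n)))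
    (fun j => j.elim (μ.real B) fun j => j.elim (μ.real Uᶜ) fun j =>
      μ.real (D (j + 1)) - μ.real (D j))
    (fun j => j.elim (μ.real B) fun j => j.elim 1 fun j => μ.real (D (j + 1)))
    (fun j => j.elim 1 fun j => j.elim (i - 1) fun _ => 0)
    (by
      rintro (_ | _ | j)
      · exact hB.2
      · exact hUc
      · exact sub_self (1 : ZMod (residueCard K - 1)) ▸ (hD (j + 1) j.2).2.sub (hD j j.2.le).2)
    (by
      rintro (_ | _ | j)
      · exact hB
      · exact ⟨one_pos, CongrMod.one _⟩
      · exact hD (j + 1) j.2)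
  convert key using 1
  · ext s
    simp only [Fintype.sum_option, Option.elim, outerSum, Real.one_rpow, mul_one,
      Finset.sum_range, D, n]
    push_cast
    rw [add_comm, add_comm (μ.real Uᶜ)]
    congr 2
    exact Finset.sum_congr rfl fun j _ => mul_comm _ _
  · simp [Fintype.sum_option]

end Congruence

/-! ### Wavelets -/

section Wavelet

variable {K : Type*} [NontriviallyNormedField K] [IsUltrametricDist K]

/-- The integral of a character over a ball on which it is not trivial vanishes. -/
theorem setIntegral_addChar_eq_zero [ProperSpace K] [MeasurableSpace K] [BorelSpace K]
    (χ : AddChar K Circle) (b a w : K) {r : ℝ} (hw : ‖w‖ ≤ r)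
    (hne : χ (b * w) ≠ 1) :
    ∫ z in closedBall a r, (χ (b * z) : ℂ) ∂(haarK K) = 0 := by
  rw [← integral_indicator measurableSet_closedBall]
  set f : K → ℂ := (closedBall a r).indicator fun z => (χ (b * z) : ℂ) with hf
  -- Translation by `w` preserves the ball, so by invariance the integral equals itself times `χ (b
  -- * w) ≠ 1`.
  have hshift (z : K) : f (z + w) = (χ (b * w) : ℂ) * f z := by
    have hmem : z + w ∈ closedBall a r ↔ z ∈ closedBall a r := by
      have hball : closedBall z r = closedBall (z + w) r :=
        IsUltrametricDist.closedBall_eq_of_mem (by simpa [mem_closedBall, dist_eq_norm] using hw)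
      rw [mem_closedBall', mem_closedBall', ← mem_closedBall, ← mem_closedBall, hball]
    by_cases hz : z ∈ closedBall a r
    · rw [hf, indicator_of_mem (hmem.2 hz), indicator_of_mem hz, mul_add, AddChar.map_add_eq_mul,
        Circle.coe_mul, mul_comm]
    · rw [hf, indicator_of_notMem (mt hmem.1 hz), indicator_of_notMem hz, mul_zero]
  have h : ∫ z, f z ∂(haarK K) = (χ (b * w) : ℂ) * ∫ z, f z ∂(haarK K) := by
    conv_lhs => rw [← integral_add_right_eq_self f w]
    simp only [hshift, integral_const_mul]
  have h1 : (1 - (χ (b * w) : ℂ)) * ∫ z, f z ∂(haarK K) = 0 := by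
    linear_combination h
  refine (mul_eq_zero.1 h1).resolve_left fun h0 => hne ?_
  exact Circle.ext (by simpa using (sub_eq_zero.1 h0).symm)

theorem integrable_indicator_addChar {X : Type*} [TopologicalSpace X] [MeasurableSpace X]
    [OpensMeasurableSpace X] {χ : AddChar K Circle} {φ : OpenPartialHomeomorph X K} {B : Set X}
    (hχ : Continuous χ) (μ : Measure X) [IsFiniteMeasure μ]
    (hB : MeasurableSet B) (hBφ : B ⊆ φ.source) (C : ℂ) (b : K) :
    Integrable (B.indicator fun x => C * (χ (b * φ x) : ℂ)) μ := by
  rw [integrable_indicator_iff hB]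
  have hcont : ContinuousOn (fun x => C * (χ (b * φ x) : ℂ)) B := by
    have h : Continuous fun z : K => C * (χ (b * z) : ℂ) := by fun_prop
    exact h.comp_continuousOn (φ.continuousOn.mono hBφ)
  refine IntegrableOn.of_bound (measure_lt_top μ B) (hcont.aestronglyMeasurable hB) ‖C‖ ?_
  filter_upwards with x
  rw [norm_mul, Circle.norm_coe, mul_one]

variable {X : Type*} [TopologicalSpace X] [ProperSpace K] [MeasurableSpace K] [BorelSpace K]
  {𝒜 : Set (OpenPartialHomeomorph X K)} {R : ℝ} {χ : AddChar K Circle} {ϖ : 𝒪[K]}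
  {φ : OpenPartialHomeomorph X K} {B U : Set X} {u : X → ℂ}

/-- The data of a wavelet: its amplitude `C`, the coefficient `b` in the argument of the character,
and the radius `‖ϖ‖ ^ k` of its ball; the character `z ↦ χ (b z)` is trivial on the ball around zero
of radius `‖ϖ‖ ^ (k + 1)`, but not on that of radius `‖ϖ‖ ^ k`. -/
theorem IsWavelet.exists_data (hϖ : Irreducible ϖ) (hχ : IsStandardCharacter χ)
    (hu : IsWavelet 𝒜 R χ ϖ φ B u) :
    ∃ (C : ℂ) (a b w : K) (k : ℤ), C ≠ 0 ∧ ‖(ϖ : K)‖ ^ k ≤ R ∧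
      φ '' B = closedBall a (‖(ϖ : K)‖ ^ k) ∧
      (∀ z, ‖z‖ ≤ ‖(ϖ : K)‖ ^ (k + 1) → χ (b * z) = 1) ∧ ‖w‖ ≤ ‖(ϖ : K)‖ ^ k ∧ χ (b * w) ≠ 1 ∧
      u = B.indicator fun x => C * (χ (b * φ x) : ℂ) := by
  obtain ⟨-, -, a, d, j, hj, hd, himg, rfl⟩ := hu
  have hπ := hϖ.isUniformiser
  have hj0 : j ≠ 0 := norm_pos_iff.1 (hj ▸ one_pos)
  obtain ⟨z, hz, hzne⟩ := hχ.2.2 ϖ hϖ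
  rw [norm_zpow] at hd himg
  -- The witness `w` is chosen so that `b * w = ϖ⁻¹ * z`, where the character is known to be
  -- nontrivial.
  refine ⟨_, a, (ϖ : K) ^ (d - 1) * j, (ϖ : K) ^ (-d) * j⁻¹ * z, -d, ?_, hd, himg,
    fun y hy => hχ.2.1 _ ?_, ?_, ?_, rfl⟩
  · rw [Complex.ofReal_ne_zero]
    refine (Real.rpow_pos_of_pos ?_ _).ne'
    rw [himg, Measure.real, haarK_closedBall hπ]
    have hq := residueCard_pos (K := K)
    rw [ENNReal.toReal_ofReal (zpow_pos hq _).le]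
    exact zpow_pos hq _
  · rw [norm_mul, norm_mul, hj, mul_one, norm_zpow]
    calc ‖(ϖ : K)‖ ^ (d - 1) * ‖y‖ ≤ ‖(ϖ : K)‖ ^ (d - 1) * ‖(ϖ : K)‖ ^ (-d + 1) :=
          mul_le_mul_of_nonneg_left hy (hπ.zpow_pos _).le
      _ = 1 := by
          rw [← zpow_add₀ hπ.pos.ne']
          simp
  · rw [norm_mul, norm_mul, norm_inv, hj, inv_one, mul_one, norm_zpow]
    exact mul_le_of_le_one_right (hπ.zpow_pos _).le hz
  · convert hzne using 2
    rw [← zpow_neg_one (ϖ : K), show (-1 : ℤ) = (d - 1) + -d by ring, zpow_add₀ hπ.ne_zero]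
    field_simp

variable [MeasurableSpace X] [OpensMeasurableSpace X]

/-- A wavelet has mean zero if the form is a multiple of the Haar measure on its ball. -/
theorem AnalyticOneForm.IsVolume.integral_indicator_addChar_eq_zero [ChartedSpace K X]
    {η : AnalyticOneForm K X} {μ : Measure X}
    (hμ : η.IsVolume μ) (hχ : Continuous χ)
    (hφ : φ ∈ analyticCharts K X) (hB : MeasurableSet B) (hBφ : B ⊆ φ.source) {c : ℝ≥0∞}
    (hc : ∀ z ∈ φ '' B, normAbs (η.coeff φ z) = c) {a : K} {r : ℝ}
    (himg : φ '' B = closedBall a r) (C : ℂ) {b w : K} (hw : ‖w‖ ≤ r) (hne : χ (b * w) ≠ 1) :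
    ∫ x, B.indicator (fun x => C * (χ (b * φ x) : ℂ)) x ∂μ = 0 := by
  have hae := φ.aemeasurable_restrict hB hBφ μ
  -- Constancy of the density moves the integral to the Haar measure on a ball of `K`.
  have hmap : (μ.restrict B).map φ = c • (haarK K).restrict (closedBall a r) := by
    ext E hE
    have hpre : φ '' (φ ⁻¹' E ∩ B) = E ∩ closedBall a r := by
      rw [image_preimage_inter, himg]
    have hm : MeasurableSet (φ ⁻¹' E ∩ B) := by
      convert (φ.measurableSet_source_inter_preimage hE).inter hB using 1
      ext x
      exact ⟨fun h => ⟨⟨hBφ h.2, h.1⟩, h.2⟩, fun h => ⟨h.1.2, h.2⟩⟩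
    rw [Measure.map_apply_of_aemeasurable hae hE, Measure.restrict_apply' hB,
      hμ φ hφ _ hm (inter_subset_right.trans hBφ), hpre, Measure.smul_apply, smul_eq_mul,
      Measure.restrict_apply hE,
      setLIntegral_congr_fun (g := fun _ => c) (hE.inter measurableSet_closedBall)
        fun z hz => hc z (himg ▸ hz.2),
      setLIntegral_const]
  have hcont : Continuous fun z : K => C * (χ (b * z) : ℂ) := by fun_prop
  rw [integral_indicator hB, ← integral_map (φ := φ) hae
    (f := fun z : K => C * (χ (b * z) : ℂ)) hcont.aestronglyMeasurable, hmap,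
    integral_smul_measure, integral_const_mul, setIntegral_addChar_eq_zero χ b a w hw hne,
    mul_zero, smul_zero]

/-- The eigenvalues of a wavelet on a manifold whose total volume is congruent to `i`. -/
theorem IsWavelet.eigenvalues [ChartedSpace K X] (hϖ : Irreducible ϖ)
    (hχ : IsStandardCharacter χ) (h𝒜 : IsEqualisingAtlas 𝒜 R) {η : AnalyticOneForm K X}
    (hη : η.NowhereVanishing) {μ : Measure X} [IsFiniteMeasure μ] (hμ : η.IsVolume μ)
    {i : ZMod (residueCard K - 1)} (hi : CongrMod (residueCard K - 1) (μ.real univ) i)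
    (hu : IsWavelet 𝒜 R χ ϖ φ B u) (hlarge : ∀ x ∈ B, ∃ U, IsLargestBall 𝒜 R x U) :
    ∃ F : ℝ → ℝ, ExpSumCongrMod (residueCard K - 1) F i ∧
      (∀ (s : ℝ) (lam : ℂ), HasWaveletEigenvalue 𝒜 R μ s u lam → lam = (F s : ℂ)) ∧
      ((∃ c : ℝ≥0∞, ∀ z ∈ φ '' B, normAbs (η.coeff φ z) = c) →
        ∀ s : ℝ, HasWaveletEigenvalue 𝒜 R μ s u (F s : ℂ)) := by
  have hπ := hϖ.isUniformiser
  have hφ := hu.1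
  have hBφ := hu.2.1
  obtain ⟨C, a, b, w, k, hC, hk, himg, htriv, hw, hne, rfl⟩ := hu.exists_data hϖ hχ
  have hBm : MeasurableSet B :=
    (IsBall.isOpen hπ (hπ.isBall_iff.2 ⟨φ, hφ, a, k, hk, hBφ, himg⟩)).measurableSet
  obtain ⟨U, θ, m, h⟩ := exists_isBallTower hπ h𝒜 hφ hBφ hk himg hlarge
  obtain ⟨x₀, hx₀, -⟩ : a ∈ φ '' B := himg ▸ mem_closedBall_self (hπ.zpow_pos k).le
  -- A second point of `B`, at which the wavelet takes the different value `χ (b * w) * u x₀`.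
  obtain ⟨x₁, hx₁, hx₁w⟩ : φ x₀ + w ∈ φ '' B := by
    rw [himg, IsUltrametricDist.closedBall_eq_of_mem (himg ▸ mem_image_of_mem φ hx₀)]
    simpa [mem_closedBall, dist_eq_norm] using hw
  set u := B.indicator fun x => C * (χ (b * φ x) : ℂ) with hudef
  have hint : Integrable u μ := integrable_indicator_addChar hχ.1 μ hBm hBφ C b
  have hu0 : ∀ y ∉ B, u y = 0 := fun y hy => indicator_of_notMem hy _
  have hmk := h.le_of_tower hπ hx₀
  have huc : ∀ x ∈ B, ∀ y ∈ IsBallTower.sub (ϖ : K) U θ x (k + 1), u y = u x := by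
    intro x hx y hy
    have hsub : IsBallTower.sub (ϖ : K) U θ x (k + 1) ⊆ B := by
      conv_rhs => rw [← h.sub_eq_small hx]
      exact IsBallTower.sub_mono hπ (by omega)
    have hxs := IsBallTower.mem_sub (θ := θ) (l := k + 1) hπ (h.subset hx)
    -- The small balls are measured in `θ` but the wavelet is written in `φ`; equal radii in both
    -- charts make the character constant on them.
    obtain ⟨e, he⟩ := h𝒜.exists_image_eq h.mem hφ (hsub.trans (h.subset.trans h.subset_source))
      (hsub.trans hBφ) (hπ.zpow_pos (k + 1))
      ((hπ.zpow_le_zpow.2 (by omega)).trans hk) (h.image_sub hπ hx (by omega))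
    have hye : φ y ∈ closedBall e (‖(ϖ : K)‖ ^ (k + 1)) := he ▸ mem_image_of_mem φ hy
    have hxe : φ x ∈ closedBall e (‖(ϖ : K)‖ ^ (k + 1)) := he ▸ mem_image_of_mem φ hxs
    rw [IsUltrametricDist.closedBall_eq_of_mem hxe, mem_closedBall, dist_eq_norm] at hye
    have h1 := htriv _ hye
    have h2 : b * φ y = b * (φ y - φ x) + b * φ x := by ring
    rw [hudef, indicator_of_mem (hsub hy), indicator_of_mem hx, h2, AddChar.map_add_eq_mul, h1,
      one_mul]
  have hne' : u x₁ ≠ u x₀ := by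
    rw [hudef, indicator_of_mem hx₁, indicator_of_mem hx₀, hx₁w, mul_add, AddChar.map_add_eq_mul,
      Circle.coe_mul]
    intro he
    have h1 := mul_left_cancel₀ hC he
    refine hne (Circle.ext ?_)
    exact mul_left_cancel₀ (Circle.coe_ne_zero _) (h1.trans (mul_one _).symm)
  refine ⟨_, h.expSumCongrMod hπ h𝒜 hη hμ hx₀ hi, fun s lam hlam =>
    h.eigenvalue_eq μ hπ h𝒜 hx₀ hx₁ s hint hu0 huc hne' hlam, fun ⟨c, hc⟩ s =>
    h.hasWaveletEigenvalue_of_integral_eq_zero μ hπ h𝒜 hx₀ s hint hu0 huc ?_⟩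
  exact hμ.integral_indicator_addChar_eq_zero hχ.1 (h𝒜.analytic hφ) hBm hBφ hc himg C hw hne

end Wavelet

end

/-! ### The theorem for the Tate curve -/

theorem corollary4p6 {K : Type*} [NontriviallyNormedField K] [IsUltrametricDist K]
    [ProperSpace K] [MeasurableSpace K] [BorelSpace K]
    (t : TateParameter K)
    (𝒜 : Set (OpenPartialHomeomorph (TateCurve t) K)) (R : ℝ) (h𝒜 : IsEqualisingAtlas 𝒜 R)
    (η : AnalyticOneForm K (TateCurve t)) (hη : η.NowhereVanishing)
    (χ : AddChar K Circle) (hχ : IsStandardCharacter χ)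
    (ϖ : 𝒪[K]) (hϖ : Irreducible ϖ) :
    ∃ i : ZMod (residueCard K - 1),
      HasSerreInvariant K (TateCurve t) i ∧ i = 0 ∧
      ∀ (φ : OpenPartialHomeomorph (TateCurve t) K) (B : Set (TateCurve t))
        (ψ : TateCurve t → ℂ),
        IsWavelet 𝒜 R χ ϖ φ B ψ →
        (∀ x ∈ B, ∃ U, IsLargestBall 𝒜 R x U) →
          -- for an integral exponent every eigenvalue of `ψ` is congruent to `i`
          (∀ (s : ℤ) (lam : ℂ), HasWaveletEigenvalue 𝒜 R η.measure s ψ lam →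
            ∃ l : ℝ, lam = (l : ℂ) ∧ CongrMod (residueCard K - 1) l i) ∧
          -- for real exponents the congruence holds for the eigenvalue as a function of `s`
          (∃ F : ℝ → ℝ, ExpSumCongrMod (residueCard K - 1) F i ∧
            ∀ (s : ℝ) (lam : ℂ), HasWaveletEigenvalue 𝒜 R η.measure s ψ lam → lam = (F s : ℂ)) ∧
          -- if `|η|` is a multiple of the Haar measure on `B`, then `ψ` is an eigenfunction
          ((∃ c : ℝ≥0∞, ∀ z ∈ φ '' B, normAbs (η.coeff φ z) = c) →
            ∀ s : ℝ, ∃ lam : ℂ, HasWaveletEigenvalue 𝒜 R η.measure s ψ lam) := by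
  have hπ := hϖ.isUniformiser
  obtain ⟨r, hr, hr0⟩ := TateCurve.exists_isDisjointUnionOfUnitBalls t hπ
  have hμ := AnalyticOneForm.isVolume_measure hπ hη hr
  obtain ⟨hfin, hvol⟩ := hμ.exists_univ hπ hη hr
  have : IsFiniteMeasure η.measure := ⟨hfin.lt_top⟩
  refine ⟨r, hr.hasSerreInvariant hπ hη, hr0, fun φ B ψ hψ hlarge => ?_⟩
  obtain ⟨F, hF, hlam, hex⟩ := hψ.eigenvalues hϖ hχ h𝒜 hη hμ hvol hlarge
  exact ⟨fun s lam h => ⟨F s, hlam s lam h, hF.congrMod s⟩, ⟨F, hF, hlam⟩,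
    fun hc s => ⟨_, hex hc s⟩⟩
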